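/- **Setting.** Let $N\ge 1$ and $d$ be integers, let $\mathcal H_1=\mathbb C^d$ be the one-particle space of spinless fermions on a lattice with $d$ sites, with the orthonormal basis of site states $|1\rangle,\dots,|d\rangle$, let $\mathcal H_N=\wedge^N\mathcal H_1$ be the $N$-fermion Hilbert space and $D=\binom dN$ its dimension. Let $w\in\mathbb R^D$ with $w_1\ge w_2\ge\dots\ge w_D\ge 0$ and $\sum_j w_j=1$. Let $\mathcal E^N$ be the set of density operators on $\mathcal H_N$ (positive semidefinite, trace $1$), $\mathcal E^N(w)$ the set of those whose spectrum, with multiplicities, is $w$, and $\overline{\mathcal E}^N(w)=\mathrm{conv}(\mathcal E^N(w))$. Let $\mathcal E^1_N(w)=N\,\mathrm{Tr}_{N-1}[\mathcal E^N(w)]$ be the set of one-particle reduced density matrices of elements of $\mathcal E^N(w)$, and $\overline{\mathcal E}^1_N(w)=\mathrm{conv}(\mathcal E^1_N(w))$. For a $d\times d$ matrix $\gamma$ let $\mathrm{diag}(\gamma)=(\langle i|\gamma|i\rangle)_{i=1}^d$. Let $\Sigma(w)\subset\mathbb R^d$ be the set of all spectra, with entries arranged in any order, of elements of $\overline{\mathcal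 E}^1_N(w)$. Fix Hermitian operators $t$ and $W$ on $\mathcal H_N$ (kinetic energy and interaction). The $w$-ensemble density functional is $$\mathcal G_w(n)=\inf\{\mathrm{Tr}[(t+W)\Gamma] : \Gamma\in\mathcal E^N(w),\ \mathrm{diag}(N\,\mathrm{Tr}_{N-1}\Gamma)=n\},\qquad n\in\mathbb R^d,$$ with value $+\infty$ if there is no such $\Gamma$. The relaxed functional $\overline{\mathcal G}_w$ is its lower convex envelope, $\overline{\mathcal G}_w(n)=\inf\{y\in\mathbb R : (n,y)\in\mathrm{conv}(\mathrm{epi}\,\mathcal G_w)\}$, and $\mathrm{dom}(\overline{\mathcal G}_w)=\{n:\overline{\mathcal G}_w(n)<\infty\}$. For $u,v\in\mathbb R^m$ write $v^\downarrow$ for $v$ sorted in decreasing order, and $u\prec v$ ($u$ is majorized by $v$) if $\sum_{i\le k}u^\downarrow_i\le\sum_{i\le k}v^\downarrow_i$ for all $k\le m$, with equality for $k=m$. *Generalized exclusion principle constraints.* A configuration is an $N$-element subset $\mathbf i$ of $\{1,\dots,d\}$, and $n_{\mathbf i}\in\{0,1\}^d$ is its indicator vector. A lineup is an enumeration $\mathbf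 i_1,\dots,\mathbf i_D$ of all configurations for which there are $h_1\le\dots\le h_d$ in $\mathbb R$ such that $\sum_{k\in\mathbf i_1}h_k<\sum_{k\in\mathbf i_2}h_k<\dots<\sum_{k\in\mathbf i_D}h_k$. Each lineup gives a generating vector $v=\sum_{j=1}^D w_j\,n_{\mathbf i_j}$; let $v^{(1)},\dots,v^{(R)}$ be all generating vectors. A vector $\lambda\in\mathbb R^d$ satisfies the generalized exclusion principle constraints if $\lambda\prec u$ for some convex combination $u=\sum_i p_i v^{(i)}$. **Statement.** 1. $\mathrm{dom}(\overline{\mathcal G}_w)=\mathrm{diag}\big(\overline{\mathcal E}^1_N(w)\big)=\mathrm{diag}\big(N\,\mathrm{Tr}_{N-1}[\overline{\mathcal E}^N(w)]\big)$, and this is the set of all $\mathrm{diag}(N\,\mathrm{Tr}_{N-1}\Gamma)$ with $\Gamma\in\mathcal E^N$, $\mathrm{spec}(\Gamma)\prec w$. 2. A Hermitian matrix $\gamma$ lies in $\overline{\mathcal E}^1_N(w)$ if and only if the vector of its eigenvalues (natural occupation numbers) satisfies the generalized exclusion principle constraints. 3. A site-occupation vector $n\in\mathbb R^d$ lies in $\mathrm{dom}(\overline{\mathcal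 G}_w)$ if and only if $n$ satisfies the same generalized exclusion principle constraints; that is, $\mathrm{dom}(\overline{\mathcal G}_w)=\Sigma(w)$. 4. Consequently, for every set $C\subset\mathbb R^d$ (for instance one given by a list of linear inequalities) such that a Hermitian $\gamma$ lies in $\overline{\mathcal E}^1_N(w)$ if and only if $\mathrm{spec}^\downarrow(\gamma)\in C$, a vector $n\in\mathbb R^d$ lies in $\mathrm{dom}(\overline{\mathcal G}_w)$ if and only if $n^\downarrow\in C$. -/

import Mathlib

namespace WEnsemble

noncomputable section

/-! ### Majorization and convex analysis -/

/-- The vector `v↓` with the same entries as `v`, sorted in descending order. -/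
def sortDown {m : ℕ} (v : Fin m → ℝ) : Fin m → ℝ :=
  v ∘ Tuple.sort (fun i => -v i)

/-- `v ≺ w`: every partial sum of `v↓` is at most the corresponding partial sum of `w↓`,
and the total sums agree. -/
def Majorized {m : ℕ} (v w : Fin m → ℝ) : Prop :=
  (∀ k : ℕ, k ≤ m →
    ∑ i : Fin m with i.val < k, sortDown v i ≤ ∑ i : Fin m with i.val < k, sortDown w i) ∧
  ∑ i, v i = ∑ i, w i

/-- The epigraph of an extended-real valued function. -/
def epigraph {E : Type*} (f : E → EReal) : Set (E × ℝ) :=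
  {p | f p.1 ≤ (p.2 : EReal)}

/-- The lower convex envelope of `f`: the function determined by the convex hull of the
epigraph of `f`. -/
def convEnvelope {E : Type*} [AddCommGroup E] [Module ℝ E] (f : E → EReal) (x : E) : EReal :=
  sInf {c : EReal | ∃ y : ℝ, (x, y) ∈ convexHull ℝ (epigraph f) ∧ c = (y : EReal)}

/-- The domain of a function with values in the extended reals: the points where it is `< ∞`. -/
def effDomain {E : Type*} (f : E → EReal) : Set E :=
  {x | f x < ⊤}

/-! ### Fermions on a lattice with `d` sites

The one-particle space is `ℂ^d` with the lattice site states as standard basis. The space of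
`N` distinguishable particles is `(ℂ^d)^{⊗N}`, written as wave functions `ψ(x₁, …, x_N)` of
`N` sites with the `ℓ²` inner product. -/

/-- The `N`-fold tensor power of the one-particle space `ℂ^d`. -/
abbrev TensorSpace (N d : ℕ) : Type := EuclideanSpace ℂ (Fin N → Fin d)

/-- The `N`-fermion Hilbert space `⋀^N ℂ^d`: the totally antisymmetric wave functions. -/
def fermionSpace (N d : ℕ) : Submodule ℂ (TensorSpace N d) where
  carrier := {ψ | ∀ (σ : Equiv.Perm (Fin N)) (x : Fin N → Fin d),
    ψ (x ∘ σ) = ((Equiv.Perm.sign σ : ℤ) : ℂ) * ψ x}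
  add_mem' := by
    intro a b ha hb σ x
    simp only [Set.mem_ofPred_eq] at ha hb
    simp [ha σ x, hb σ x, mul_add]
  zero_mem' := by
    intro σ x
    simp
  smul_mem' := by
    intro c a ha σ x
    simp only [Set.mem_ofPred_eq] at ha
    simp [ha σ x, mul_left_comm]

/-- Linear operators on the `N`-fermion Hilbert space. -/
abbrev FermionOp (N d : ℕ) : Type := fermionSpace N d →ₗ[ℂ] fermionSpace N d

/-- Hermitian operators on the `N`-fermion Hilbert space. -/
def HermitianOp {N d : ℕ} (A : FermionOp N d) : Prop :=
  LinearMap.IsSymmetric (𝕜 := ℂ) (E := fermionSpace N d) A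

/-- The operator on the tensor power that agrees with `Γ` on the antisymmetric wave functions
and vanishes on their orthogonal complement. -/
def extendOp {N d : ℕ} (Γ : FermionOp N d) : TensorSpace N d →ₗ[ℂ] TensorSpace N d :=
  (fermionSpace N d).subtype ∘ₗ Γ ∘ₗ
    ((fermionSpace N d).orthogonalProjectionOnto : TensorSpace N d →ₗ[ℂ] fermionSpace N d)

/-- The matrix element `⟨x₁ ⊗ … ⊗ x_N| Γ |y₁ ⊗ … ⊗ y_N⟩`. -/
def matrixElement {N d : ℕ} (Γ : FermionOp N d) (x y : Fin N → Fin d) : ℂ :=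
  extendOp Γ (EuclideanSpace.single y 1) x

/-- The one-particle reduced density matrix `N Tr_{N-1}[Γ]` for `N = n + 1` fermions, as a matrix
with respect to the lattice site states: all particles but the first are traced out. -/
def oneRDM {n d : ℕ} (Γ : FermionOp (n + 1) d) : Matrix (Fin d) (Fin d) ℂ :=
  Matrix.of fun i j =>
    ((n + 1 : ℕ) : ℂ) * ∑ x : Fin n → Fin d,
      matrixElement Γ (Fin.cons i x : Fin (n + 1) → Fin d) (Fin.cons j x : Fin (n + 1) → Fin d)

/-- `diag(γ)`: the vector of diagonal entries, i.e. the occupation numbers of the lattice sites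
(these entries are real for Hermitian `γ`). -/
def diagVec {d : ℕ} (γ : Matrix (Fin d) (Fin d) ℂ) : Fin d → ℝ :=
  fun i => (γ i i).re

/-- The operator `Γ` has the entries of `w` as its eigenvalues, counted with multiplicity. -/
def OpHasSpectrum {N d m : ℕ} (Γ : FermionOp N d) (w : Fin m → ℝ) : Prop :=
  Γ.charpoly.roots = Finset.univ.val.map fun j => (w j : ℂ)

/-- The matrix `γ` has the entries of `μ` as its eigenvalues, counted with multiplicity. -/
def MatHasSpectrum {d : ℕ} (γ : Matrix (Fin d) (Fin d) ℂ) (μ : Fin d → ℝ) : Prop :=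
  γ.charpoly.roots = Finset.univ.val.map fun j => (μ j : ℂ)

/-- The set of all `N`-fermion density operators. -/
def densityOps (N d : ℕ) : Set (FermionOp N d) :=
  {Γ | LinearMap.IsPositive (𝕜 := ℂ) (E := fermionSpace N d) Γ ∧ LinearMap.trace ℂ (fermionSpace N d) Γ = 1}

/-- The set of all `N`-fermion density operators with spectrum `w`; here
`d.choose N` is the dimension of the `N`-fermion space. -/
def ensN (N d : ℕ) (w : Fin (d.choose N) → ℝ) : Set (FermionOp N d) :=
  {Γ | Γ ∈ densityOps N d ∧ OpHasSpectrum Γ w}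

/-- The relaxed set of `N`-fermion density operators. -/
def relaxedEnsN (N d : ℕ) (w : Fin (d.choose N) → ℝ) : Set (FermionOp N d) :=
  convexHull ℝ (ensN N d w)

/-- The `w`-ensemble `N`-representable one-particle reduced density matrices, `N = n + 1`. -/
def ens1 (n d : ℕ) (w : Fin (d.choose (n + 1)) → ℝ) : Set (Matrix (Fin d) (Fin d) ℂ) :=
  oneRDM '' ensN (n + 1) d w

/-- The relaxed `w`-ensemble `N`-representable one-particle reduced density matrices. -/
def relaxedEns1 (n d : ℕ) (w : Fin (d.choose (n + 1)) → ℝ) : Set (Matrix (Fin d) (Fin d) ℂ) :=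
  convexHull ℝ (ens1 n d w)

/-- The set of all spectra, arranged in any order, of relaxed `w`-ensemble `N`-representable
one-particle reduced density matrices. -/
def spectralPolytope (n d : ℕ) (w : Fin (d.choose (n + 1)) → ℝ) : Set (Fin d → ℝ) :=
  {μ | ∃ γ ∈ relaxedEns1 n d w, MatHasSpectrum γ μ}

/-! ### The density functional -/

/-- The `w`-ensemble density functional of the Hamiltonians `v + t + W` with fixed `t`, `W`:
the constrained minimum of `Tr[(t + W) Γ]` over density operators `Γ` with spectrum `w` and site
occupation numbers `occ`, and `∞` if there is no such `Γ`. -/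
def densityFunctional {n d : ℕ} (w : Fin (d.choose (n + 1)) → ℝ) (t W : FermionOp (n + 1) d)
    (occ : Fin d → ℝ) : EReal :=
  sInf {c : EReal | ∃ Γ ∈ ensN (n + 1) d w, diagVec (oneRDM Γ) = occ ∧
    c = (((LinearMap.trace ℂ (fermionSpace (n + 1) d) ((t + W) ∘ₗ Γ)).re : ℝ) : EReal)}

/-- The relaxed `w`-ensemble density functional: the lower convex envelope of the
`w`-ensemble density functional. -/
def relaxedDensityFunctional {n d : ℕ} (w : Fin (d.choose (n + 1)) → ℝ)
    (t W : FermionOp (n + 1) d) : (Fin d → ℝ) → EReal :=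
  convEnvelope (densityFunctional w t W)

/-! ### The generalized exclusion principle constraints -/

/-- `N`-fermion configurations: `N`-element sets of orbitals. -/
abbrev Config (N d : ℕ) : Type := {s : Finset (Fin d) // s.card = N}

/-- The occupation number vector of a configuration. -/
def occVec {N d : ℕ} (s : Config N d) : Fin d → ℝ :=
  fun k => if k ∈ s.val then 1 else 0

/-- A lineup: a list of all configurations in increasing order of their energies `∑_{k ∈ s} h k`,
for some energy levels `h 0 ≤ h 1 ≤ …` for which the energies of different configurations
are different. -/
def IsLineup {N d : ℕ} (c : Fin (d.choose N) ≃ Config N d) : Prop :=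
  ∃ h : Fin d → ℝ, Monotone h ∧ StrictMono fun j => ∑ k ∈ (c j).val, h k

/-- The (finitely many) generating vectors `∑_j w_j n_{i_j}`, one for each lineup
`i_1 → i_2 → …`; only the configurations with nonvanishing weight contribute. -/
def generatingVectors (N d : ℕ) (w : Fin (d.choose N) → ℝ) : Set (Fin d → ℝ) :=
  {v | ∃ c : Fin (d.choose N) ≃ Config N d, IsLineup c ∧ v = ∑ j, w j • occVec (c j)}

/-- The generalized exclusion principle constraints: `μ` is majorized by some convex
combination of the generating vectors. -/
def ExclusionPrinciple (N d : ℕ) (w : Fin (d.choose N) → ℝ) (μ : Fin d → ℝ) : Prop :=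
  ∃ u ∈ convexHull ℝ (generatingVectors N d w), Majorized μ u

end

end WEnsemble

open WEnsemble

open Finset

namespace WEnsemble

/-! Everything is compared with one polytope P, the convex hull of `configMixtures`: the occupation
vectors of mixtures of configurations with weights `w` in any order, not only in the order of a
lineup.

Site occupations fill P. The occupation vector of Γ is a linear image of the diagonal of Γ in the
Slater basis. By Schur's theorem that diagonal is a convex combination of rearrangements of `w`, so
the occupation vector lies in P (`diagVec_mem_of_mem_relaxedEns1`). Conversely, Slater determinants
mixed with weights `w` have diagonal reduced density matrices, which realize P
(`diagonal_mem_relaxedEns1`). Passing to the convex envelope replaces a domain by its convex hull.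

Spectra fill P as well. The maps U ⊗ ⋯ ⊗ U conjugate the reduced density matrix by U, so
`relaxedEns1` is unitarily invariant and only diagonal matrices matter (`mem_relaxedEns1_iff`).

The exclusion principle describes P (`exclusionPrinciple_iff`). For a generic linear functional the
rearrangement inequality places the optimum over `configMixtures` at a relabelled lineup, so P is
the hull of the rearranged generating vectors. Generating vectors are decreasing, so their partial
sums are additive under convex combination, and Rado's theorem turns this hull into majorization by
a convex combination of generating vectors. -/

/-! ### Majorization -/

/-- A point outside the convex hull of a finite set is strictly separated from it. -/
theorem exists_sum_mul_lt_of_notMem_convexHull {m : ℕ} {s : Set (Fin m → ℝ)} (hs : s.Finite)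
    {x : Fin m → ℝ} (hx : x ∉ convexHull ℝ s) :
    ∃ h : Fin m → ℝ, ∀ a ∈ s, ∑ i, h i * a i < ∑ i, h i * x i := by
  obtain ⟨f, u, h1, h2⟩ := geometric_hahn_banach_closed_point (convex_convexHull ℝ s)
    (hs.isClosed_convexHull ℝ) hx
  have key (y : Fin m → ℝ) :
      ∑ i, f (fun j => if i = j then 1 else 0) * y i = f y := by
    rw [← ContinuousLinearMap.coe_coe f, LinearMap.pi_apply_eq_sum_univ (f : _ →ₗ[ℝ] ℝ) y]
    exact sum_congr rfl fun i _ => mul_comm _ _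
  refine ⟨fun i => f (fun j => if i = j then 1 else 0), fun a ha => ?_⟩
  rw [key, key]
  exact (h1 a (subset_convexHull ℝ s ha)).trans h2

theorem antitone_sortDown {m : ℕ} (v : Fin m → ℝ) : Antitone (sortDown v) := by
  have h := Tuple.monotone_sort (fun i => -v i)
  intro i j hij
  have := h hij
  simpa [sortDown] using this

theorem sortDown_of_antitone {m : ℕ} {v : Fin m → ℝ} (hv : Antitone v) : sortDown v = v := by
  have : Tuple.sort (fun i => -v i) = Equiv.refl _ :=
    Tuple.sort_eq_refl_iff_monotone.2 fun i j hij => neg_le_neg (hv hij)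
  rw [sortDown, this]
  rfl

/-- The sum of the `k` largest entries of `v`. -/
noncomputable def topSum {m : ℕ} (k : ℕ) (v : Fin m → ℝ) : ℝ :=
  ∑ i : Fin m with i.val < k, sortDown v i

theorem card_filter_val_lt {m k : ℕ} (hk : k ≤ m) :
    (univ.filter fun i : Fin m => i.val < k).card = k := by
  simp [Fin.card_filter_val_lt, hk]

/-- Subtract the smallest value `c` taken on the initial segment: what remains is nonnegative on the
segment and nonpositive off it, and the two sets have the same size. -/
theorem sum_le_sum_filter_val_lt {m : ℕ} {g : Fin m → ℝ} (hg : Antitone g) (S : Finset (Fin m)) :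
    ∑ i ∈ S, g i ≤ ∑ i : Fin m with i.val < S.card, g i := by
  have hSm : S.card ≤ m := by simpa using S.card_le_univ
  rcases Nat.eq_zero_or_pos S.card with h0 | h0
  · have : S = ∅ := card_eq_zero.1 h0
    simp [this]
  set T := univ.filter fun i : Fin m => i.val < S.card with hT
  have hTc : T.card = S.card := card_filter_val_lt hSm
  let c := g ⟨S.card - 1, by omega⟩
  have hle : ∑ i ∈ S, (g i - c) ≤ ∑ i ∈ T, (g i - c) := by
    calc ∑ i ∈ S, (g i - c) ≤ ∑ i ∈ S with i ∈ T, (g i - c) := by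
          rw [sum_filter]
          refine sum_le_sum fun i _ => ?_
          split_ifs with h
          · exact le_rfl
          · have : g i ≤ c := hg (Fin.mk_le_of_le_val (by simp [hT] at h; omega))
            linarith
      _ ≤ ∑ i ∈ T, (g i - c) := by
          refine sum_le_sum_of_subset_of_nonneg (fun i hi => (mem_filter.1 hi).2) fun i hi _ => ?_
          have : c ≤ g i := hg (Fin.le_def.2 (by simp [hT] at hi; simp; omega))
          linarith
  rw [sum_sub_distrib, sum_sub_distrib, sum_const, sum_const, hTc] at hle
  linarith

theorem sum_le_topSum {m : ℕ} (v : Fin m → ℝ) (S : Finset (Fin m)) :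
    ∑ i ∈ S, v i ≤ topSum S.card v := by
  have := sum_le_sum_filter_val_lt (antitone_sortDown v)
    (S.map (Tuple.sort fun i => -v i).symm.toEmbedding)
  simpa [topSum, sortDown] using this

theorem exists_sum_eq_topSum {m k : ℕ} (hk : k ≤ m) (v : Fin m → ℝ) :
    ∃ S : Finset (Fin m), S.card = k ∧ ∑ i ∈ S, v i = topSum k v := by
  refine ⟨(univ.filter fun i : Fin m => i.val < k).map (Tuple.sort fun i => -v i).toEmbedding,
    ?_, ?_⟩
  · rw [card_map, card_filter_val_lt hk]
  · simp [topSum, sortDown]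

/-- Testing all subsets instead of sorting `u` makes every condition linear in `u`. -/
theorem majorized_iff {m : ℕ} {u v : Fin m → ℝ} :
    Majorized u v ↔ (∀ S : Finset (Fin m), ∑ i ∈ S, u i ≤ topSum S.card v) ∧
      ∑ i, u i = ∑ i, v i := by
  refine and_congr_left fun _ => ⟨fun h S => ?_, fun h k hk => ?_⟩
  · exact (sum_le_topSum u S).trans (h _ (by simpa using S.card_le_univ))
  · obtain ⟨S, hS, hsum⟩ := exists_sum_eq_topSum hk u
    have := h S
    rw [hsum, hS] at this
    exact this

theorem majorized_comp_perm {m : ℕ} (v : Fin m → ℝ) (σ : Equiv.Perm (Fin m)) :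
    Majorized (v ∘ σ) v := by
  refine majorized_iff.2 ⟨fun S => ?_, Equiv.sum_comp σ v⟩
  have := sum_le_topSum v (S.map σ.toEmbedding)
  simpa using this

theorem convex_setOf_majorized {m : ℕ} (v : Fin m → ℝ) : Convex ℝ {u | Majorized u v} := by
  intro x hx y hy a b ha hb hab
  simp only [Set.mem_ofPred_eq, majorized_iff] at hx hy ⊢
  refine ⟨fun S => ?_, ?_⟩
  · simp only [Pi.add_apply, Pi.smul_apply, smul_eq_mul, sum_add_distrib, ← mul_sum]
    calc _ ≤ a * topSum S.card v + b * topSum S.card v := by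
          gcongr
          · exact hx.1 S
          · exact hy.1 S
      _ = _ := by rw [← add_mul, hab, one_mul]
  · simp only [Pi.add_apply, Pi.smul_apply, smul_eq_mul, sum_add_distrib, ← mul_sum, hx.2, hy.2]
    rw [← add_mul, hab, one_mul]

/-- Summation by parts: pairing an antitone sequence with one whose partial sums are
nonnegative. -/
theorem mul_sum_le_sum_mul_of_antitone {m : ℕ} {a z : Fin m → ℝ} (ha : Antitone a)
    (hz : ∀ k ≤ m, 0 ≤ ∑ i : Fin m with i.val < k, z i) {c : ℝ} (hc : ∀ i, c ≤ a i) :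
    c * ∑ i, z i ≤ ∑ i, a i * z i := by
  induction m generalizing c with
  | zero => simp
  | succ m ih =>
    have htot : 0 ≤ ∑ i, z i := by
      have := hz (m + 1) le_rfl
      rwa [filter_true_of_mem fun i _ => i.isLt] at this
    -- The last value of `a` bounds the earlier ones from below; lowering it to `c` afterwards costs
    -- nothing because the total of `z` is nonnegative.
    have h1 := ih (a := fun i => a i.castSucc) (z := fun i => z i.castSucc)
      (fun i j hij => ha (Fin.castSucc_le_castSucc_iff.2 hij))
      (fun k hk => by
        have := hz k (hk.trans (Nat.le_succ m))
        rw [sum_filter, Fin.sum_univ_castSucc] at this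
        rw [sum_filter]
        simpa [not_lt.2 hk] using this)
      (c := a (Fin.last m)) (fun i => ha (Fin.le_last _))
    have h2 := mul_le_mul_of_nonneg_right (hc (Fin.last m)) htot
    rw [Fin.sum_univ_castSucc] at h2 ⊢
    rw [Fin.sum_univ_castSucc]
    linarith

/-- Hardy, Littlewood, Pólya, and Rado: the vectors majorized by `v` form the convex hull of the
rearrangements of `v`. -/
theorem majorized_iff_mem_convexHull {m : ℕ} {u v : Fin m → ℝ} :
    Majorized u v ↔
      u ∈ convexHull ℝ (Set.range fun σ : Equiv.Perm (Fin m) => v ∘ σ) := by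
  constructor
  · intro h
    by_contra hu
    obtain ⟨h', hsep⟩ := exists_sum_mul_lt_of_notMem_convexHull (Set.finite_range _) hu
    set ρ := Tuple.sort fun i => -h' i with hρ
    set τ := Tuple.sort fun i => -v i with hτ
    -- This rearrangement puts the largest entries of `v` where `h'` is largest; its pairing with
    -- `h'` should dominate that of `u`.
    have h1 := hsep _ ⟨ρ.symm.trans τ, rfl⟩
    rw [← Equiv.sum_comp ρ, ← Equiv.sum_comp ρ fun i => h' i * u i] at h1
    have hz : ∀ k ≤ m, 0 ≤ ∑ i : Fin m with i.val < k, (v (τ i) - u (ρ i)) := by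
      intro k hk
      rw [sum_sub_distrib, sub_nonneg]
      have := (majorized_iff.1 h).1 ((univ.filter fun i : Fin m => i.val < k).map ρ.toEmbedding)
      rw [card_map, card_filter_val_lt hk, sum_map] at this
      exact this
    have hsum : ∑ i, (v (τ i) - u (ρ i)) = 0 := by
      rw [sum_sub_distrib, Equiv.sum_comp τ v, Equiv.sum_comp ρ u, h.2, sub_self]
    -- Any lower bound will do, since it multiplies a total that is zero.
    obtain ⟨c, hc⟩ : ∃ c, ∀ i, c ≤ h' (ρ i) := by
      obtain ⟨c, hc⟩ := (Set.finite_range fun i => h' (ρ i)).bddBelow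
      exact ⟨c, fun i => hc ⟨i, rfl⟩⟩
    have h2 := mul_sum_le_sum_mul_of_antitone (antitone_sortDown h') hz hc
    rw [hsum, mul_zero] at h2
    simp only [mul_sub, sum_sub_distrib] at h2
    simp only [Function.comp, Equiv.trans_apply, Equiv.symm_apply_apply] at h1
    exact absurd h1 (not_lt.2 (sub_nonneg.1 h2))
  · intro h
    refine convexHull_min ?_ (convex_setOf_majorized v) h
    rintro _ ⟨σ, rfl⟩
    exact majorized_comp_perm v σ

/-- Birkhoff's theorem, pushed forward along the linear map `B ↦ B.mulVec v`. -/
theorem mulVec_mem_convexHull_of_doublyStochastic {ι : Type*} [Fintype ι] [DecidableEq ι]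
    {B : Matrix ι ι ℝ} (hB : B ∈ doublyStochastic ℝ ι) (v : ι → ℝ) :
    B.mulVec v ∈ convexHull ℝ (Set.range fun σ : Equiv.Perm ι => v ∘ σ) := by
  let f : Matrix ι ι ℝ →ₗ[ℝ] (ι → ℝ) := (Matrix.mulVecBilin ℝ ℝ).flip v
  have h1 : f B ∈ f '' convexHull ℝ {x | ∃ σ : Equiv.Perm ι, σ.permMatrix ℝ = x} := by
    rw [← doublyStochastic_eq_convexHull_permMatrix]
    exact ⟨B, hB, rfl⟩
  rw [LinearMap.image_convexHull] at h1
  refine convexHull_mono ?_ h1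
  rintro _ ⟨_, ⟨σ, rfl⟩, rfl⟩
  exact ⟨σ, (Matrix.permMatrix_mulVec σ).symm⟩

theorem sortDown_comp_perm {m : ℕ} (v : Fin m → ℝ) (σ : Equiv.Perm (Fin m)) :
    sortDown (v ∘ σ) = sortDown v := by
  have h := Tuple.comp_perm_comp_sort_eq_comp_sort (f := fun i => -v i) (σ := σ)
  funext i
  have := congrFun h i
  simpa [sortDown, Function.comp_def] using this

/-! ### Generating vectors -/

/-- The occupation numbers of the mixtures of configurations with weights `w` in any order. -/
def configMixtures (N d : ℕ) (w : Fin (d.choose N) → ℝ) : Set (Fin d → ℝ) :=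
  Set.range fun c : Fin (d.choose N) ≃ Config N d => ∑ j, w j • occVec (c j)

theorem finite_configMixtures {N d : ℕ} (w : Fin (d.choose N) → ℝ) : (configMixtures N d w).Finite :=
  Set.finite_range _

/-- Relabelling the orbitals of a configuration. -/
def configPerm {N d : ℕ} (σ : Equiv.Perm (Fin d)) : Equiv.Perm (Config N d) :=
  (Equiv.finsetCongr σ).subtypeEquiv fun s => by simp

theorem occVec_configPerm {N d : ℕ} (σ : Equiv.Perm (Fin d)) (s : Config N d) :
    occVec (configPerm σ.symm s) = occVec s ∘ σ := by
  funext k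
  simp [occVec, configPerm, Equiv.finsetCongr]

theorem sum_configPerm {N d : ℕ} (σ : Equiv.Perm (Fin d)) (s : Config N d) (h : Fin d → ℝ) :
    ∑ k ∈ (configPerm σ s).val, h k = ∑ k ∈ s.val, h (σ k) := by
  simp [configPerm, Equiv.finsetCongr]

theorem comp_perm_mem_configMixtures {N d : ℕ} {w : Fin (d.choose N) → ℝ} {v : Fin d → ℝ}
    (hv : v ∈ configMixtures N d w) (σ : Equiv.Perm (Fin d)) : v ∘ σ ∈ configMixtures N d w := by
  obtain ⟨c, rfl⟩ := hv
  refine ⟨c.trans (configPerm σ.symm), ?_⟩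
  funext k
  simp [occVec_configPerm]

theorem comp_perm_mem_convexHull {m : ℕ} {s t : Set (Fin m → ℝ)} (σ : Equiv.Perm (Fin m))
    (hs : ∀ v ∈ s, v ∘ σ ∈ t) {x : Fin m → ℝ} (hx : x ∈ convexHull ℝ s) :
    x ∘ σ ∈ convexHull ℝ t := by
  have h1 : x ∘ σ ∈ LinearMap.funLeft ℝ ℝ σ '' convexHull ℝ s := ⟨x, hx, rfl⟩
  rw [LinearMap.image_convexHull] at h1
  refine convexHull_mono ?_ h1
  rintro _ ⟨v, hv, rfl⟩
  exact hs v hv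

/-- Replacing the orbital `l` by a lower one `k` does not raise the energy, so the new configuration
comes no later in the lineup and has at least the same weight. -/
theorem antitone_of_mem_generatingVectors {N d : ℕ} {w : Fin (d.choose N) → ℝ} (hw : Antitone w)
    {v : Fin d → ℝ} (hv : v ∈ generatingVectors N d w) : Antitone v := by
  obtain ⟨c, ⟨h, hmono, hstrict⟩, rfl⟩ := hv
  intro k l hkl
  rcases eq_or_lt_of_le hkl with rfl | hlt
  · exact le_rfl
  -- The permutation of positions in the lineup induced by exchanging `k` and `l`.
  let τ : Equiv.Perm (Fin (d.choose N)) :=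
    (c.trans (configPerm (Equiv.swap k l))).trans c.symm
  have hτ (j) : c (τ j) = configPerm (Equiv.swap k l) (c j) := by simp [τ]
  have hmem (j) (i) : i ∈ (c (τ j)).val ↔ Equiv.swap k l i ∈ (c j).val := by
    rw [hτ]
    simp [configPerm, Equiv.finsetCongr]
  simp only [Finset.sum_apply, Pi.smul_apply, smul_eq_mul]
  rw [← Equiv.sum_comp τ fun j => w j * occVec (c j) k]
  refine sum_le_sum fun j _ => ?_
  simp only [occVec, hmem, Equiv.swap_apply_left]
  split_ifs with hl
  · by_cases hk : k ∈ (c j).val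
    · have : c (τ j) = c j := by
        apply Subtype.ext
        ext i
        rw [hmem]
        rcases eq_or_ne i k with rfl | hik
        · simp [hl, hk]
        rcases eq_or_ne i l with rfl | hil
        · simp [hl, hk]
        rw [Equiv.swap_apply_of_ne_of_ne hik hil]
      rw [c.injective this]
    · have hle : τ j ≤ j := by
        rw [← hstrict.le_iff_le]
        simp only [hτ, sum_configPerm]
        refine sum_le_sum fun i hi => ?_
        rcases eq_or_ne i k with rfl | hik
        · exact absurd hi hk
        rcases eq_or_ne i l with rfl | hil
        · simpa using hmono hkl
        rw [Equiv.swap_apply_of_ne_of_ne hik hil]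
      simpa using hw hle
  · simp

/-- Energy levels can be perturbed so that different configurations have different energies. -/
theorem exists_generic_perturbation (N d : ℕ) (h : Fin d → ℝ) {P : (Fin d → ℝ) → Prop}
    (hP : ∀ᶠ h' in nhds h, P h') :
    ∃ h', P h' ∧ Function.Injective fun s : Config N d => ∑ k ∈ s.val, h' k := by
  -- Uniqueness of binary expansions gives distinct configurations distinct sums.
  let g : Fin d → ℝ := fun k => ((2 ^ k.val : ℕ) : ℝ)
  have hg : ∀ s t : Config N d, s ≠ t → ∑ k ∈ s.val, g k ≠ ∑ k ∈ t.val, g k := by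
    intro s t hst he
    apply hst
    apply Subtype.ext
    have he' : ∑ k ∈ s.val.map Fin.valEmbedding, 2 ^ k = ∑ k ∈ t.val.map Fin.valEmbedding, 2 ^ k := by
      have : ((∑ k ∈ s.val, 2 ^ k.val : ℕ) : ℝ) = ((∑ k ∈ t.val, 2 ^ k.val : ℕ) : ℝ) := by
        push_cast; simpa [g] using he
      simpa using (Nat.cast_injective this)
    exact map_injective _ (Finset.equivBitIndices.symm.injective he')
  have hcont : Filter.Tendsto (fun ε : ℝ => h + ε • g) (nhds 0) (nhds h) := by
    have : Continuous fun ε : ℝ => h + ε • g := by fun_prop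
    simpa using this.tendsto 0
  have hev := hcont.eventually hP
  -- For each pair, a coincidence of energies is an affine equation in ε with nonzero slope, so only
  -- finitely many ε are bad.
  have hfin : (⋃ p : Config N d × Config N d, {ε : ℝ | p.1 ≠ p.2 ∧
      ∑ k ∈ p.1.val, (h + ε • g) k = ∑ k ∈ p.2.val, (h + ε • g) k}).Finite := by
    refine Set.finite_iUnion fun p => Set.Subsingleton.finite ?_
    rintro x ⟨hne, hx⟩ y ⟨-, hy⟩
    simp only [Pi.add_apply, Pi.smul_apply, smul_eq_mul, sum_add_distrib, ← mul_sum] at hx hy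
    have := sub_ne_zero.2 (hg _ _ hne)
    apply mul_right_cancel₀ this
    linarith
  obtain ⟨ε, h1, h2⟩ := ((hev.filter_mono nhdsWithin_le_nhds).and
    (hfin.eventually_cofinite_notMem.filter_mono (nhdsNE_le_cofinite (0 : ℝ)))).exists
  refine ⟨_, h1, fun s t hst => ?_⟩
  by_contra hne
  exact h2 (Set.mem_iUnion.2 ⟨(s, t), hne, hst⟩)

theorem generatingVectors_subset_configMixtures {N d : ℕ} (w : Fin (d.choose N) → ℝ) :
    generatingVectors N d w ⊆ configMixtures N d w := by
  rintro _ ⟨c, -, rfl⟩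
  exact ⟨c, rfl⟩

theorem sum_mul_mixture {N d : ℕ} (w : Fin (d.choose N) → ℝ)
    (c : Fin (d.choose N) → Config N d) (h : Fin d → ℝ) :
    ∑ i, h i * (∑ j, w j • occVec (c j)) i = ∑ j, w j * ∑ k ∈ (c j).val, h k := by
  simp only [Finset.sum_apply, Pi.smul_apply, smul_eq_mul, mul_sum]
  rw [sum_comm]
  refine sum_congr rfl fun j _ => ?_
  rw [← sum_filter_add_sum_filter_not univ (fun i => i ∈ (c j).val)]
  rw [sum_eq_zero (s := univ.filter fun i => i ∉ (c j).val), add_zero]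
  · rw [filter_mem_eq_inter, univ_inter]
    exact sum_congr rfl fun i hi => by simp [occVec, hi, mul_comm]
  · intro i hi
    simp [occVec, (mem_filter.1 hi).2]

/-- Every mixture of configurations is a convex combination of rearranged generating vectors:
for generic energy levels the energy is minimized by a lineup. -/
theorem mem_convexHull_rearrangements {N d : ℕ} {w : Fin (d.choose N) → ℝ} (hw : Antitone w)
    {x : Fin d → ℝ} (hx : x ∈ configMixtures N d w) :
    x ∈ convexHull ℝ {y | ∃ v ∈ generatingVectors N d w, ∃ σ : Equiv.Perm (Fin d), y = v ∘ σ} := by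
  set G := {y | ∃ v ∈ generatingVectors N d w, ∃ σ : Equiv.Perm (Fin d), y = v ∘ σ} with hG
  have hGfin : G.Finite := (finite_configMixtures w).subset <| by
    rintro _ ⟨v, hv, σ, rfl⟩
    exact comp_perm_mem_configMixtures (generatingVectors_subset_configMixtures w hv) σ
  by_contra hxG
  obtain ⟨h, hsep⟩ := exists_sum_mul_lt_of_notMem_convexHull hGfin hxG
  -- Strict separation from a finite set is an open condition, so it survives the perturbation to
  -- generic levels.
  have hev : ∀ᶠ h' in nhds h, ∀ a ∈ G, ∑ i, h' i * a i < ∑ i, h' i * x i := by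
    refine (Filter.eventually_all_finite hGfin).2 fun a ha => ?_
    exact (Continuous.tendsto (by fun_prop) h).eventually_lt
      (Continuous.tendsto (by fun_prop) h) (hsep a ha)
  obtain ⟨h', hsep', hinj⟩ := exists_generic_perturbation N d h hev
  obtain ⟨c, rfl⟩ := hx
  -- A lineup needs increasing levels and puts the lowest energy first, whereas the separating
  -- functional is to be maximized: hence the levels `-h'`, relabelled by `ρ`.
  let ρ := Tuple.sort fun k => -h' k
  let E : Config N d → ℝ := fun s => ∑ k ∈ s.val, -h' (ρ k)
  have hEinj : Function.Injective E := by
    intro s t hst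
    apply (configPerm ρ).injective
    apply hinj
    simp only [E, sum_neg_distrib, neg_inj] at hst
    simpa only [sum_configPerm] using hst
  let c₀ : Fin (d.choose N) ≃ Config N d := (Tuple.sort (E ∘ c)).trans c
  have hmono : Monotone fun j => E (c₀ j) := Tuple.monotone_sort (E ∘ c)
  have hc₀ : IsLineup c₀ := ⟨fun k => -h' (ρ k), Tuple.monotone_sort fun k => -h' k,
    hmono.strictMono_of_injective (hEinj.comp c₀.injective)⟩
  have h1 := hsep' _ ⟨_, ⟨c₀, hc₀, rfl⟩, ρ.symm, rfl⟩
  rw [← Equiv.sum_comp ρ] at h1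
  simp only [Function.comp, Equiv.symm_apply_apply] at h1
  rw [sum_mul_mixture w c₀ fun i => h' (ρ i), sum_mul_mixture w c] at h1
  let τ : Equiv.Perm (Fin (d.choose N)) := (c.trans (configPerm ρ).symm).trans c₀.symm
  -- Rearrangement inequality: decreasing weights against increasing energies give the least total.
  -- The permutation `τ` recovers the relabelled order `c`.
  have h2 : ∑ j, w j • E (c₀ j) ≤ ∑ j, w j • E (c₀ (τ j)) :=
    (hw.antivary hmono).sum_smul_le_sum_smul_comp_perm
  have h3 (j) : E (c₀ (τ j)) = -∑ k ∈ (c j).val, h' k := by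
    simp only [τ, E, Equiv.trans_apply, Equiv.apply_symm_apply, sum_neg_distrib]
    rw [← sum_configPerm, Equiv.apply_symm_apply]
  simp only [h3] at h2
  simp only [E, sum_neg_distrib, smul_eq_mul, mul_neg, neg_le_neg_iff] at h2
  exact absurd h1 (not_lt.2 h2)

theorem topSum_of_antitone {m : ℕ} {u : Fin m → ℝ} (hu : Antitone u) (k : ℕ) :
    topSum k u = ∑ i : Fin m with i.val < k, u i := by
  rw [topSum, sortDown_of_antitone hu]

theorem convex_setOf_antitone (m : ℕ) : Convex ℝ {u : Fin m → ℝ | Antitone u} := by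
  intro x hx y hy a b ha hb _ i j hij
  simp only [Pi.add_apply, Pi.smul_apply, smul_eq_mul]
  exact add_le_add (mul_le_mul_of_nonneg_left (hx hij) ha) (mul_le_mul_of_nonneg_left (hy hij) hb)

/-- In general `topSum` is only convex, which is the wrong direction here. On decreasing vectors,
such as all elements of the hull of the generating vectors, it is linear, and the two majorizations
add. -/
theorem convex_setOf_exclusionPrinciple {N d : ℕ} {w : Fin (d.choose N) → ℝ} (hw : Antitone w) :
    Convex ℝ {μ | ExclusionPrinciple N d w μ} := by
  have hanti : ∀ u ∈ convexHull ℝ (generatingVectors N d w), Antitone u :=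
    convexHull_min (fun v hv => antitone_of_mem_generatingVectors hw hv)
      (convex_setOf_antitone d)
  rintro x ⟨u, hu, hxu⟩ y ⟨v, hv, hyv⟩ a b ha hb hab
  have huv := convex_convexHull ℝ _ hu hv ha hb hab
  refine ⟨_, huv, majorized_iff.2 ⟨fun S => ?_, ?_⟩⟩
  · have h1 := (majorized_iff.1 hxu).1 S
    have h2 := (majorized_iff.1 hyv).1 S
    rw [topSum_of_antitone (hanti _ hu)] at h1
    rw [topSum_of_antitone (hanti _ hv)] at h2
    rw [topSum_of_antitone (hanti _ huv)]
    simp only [Pi.add_apply, Pi.smul_apply, smul_eq_mul, sum_add_distrib, ← mul_sum]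
    gcongr
  · simp only [Pi.add_apply, Pi.smul_apply, smul_eq_mul, sum_add_distrib, ← mul_sum, hxu.2, hyv.2]

theorem exclusionPrinciple_iff {N d : ℕ} {w : Fin (d.choose N) → ℝ} (hw : Antitone w)
    {μ : Fin d → ℝ} :
    ExclusionPrinciple N d w μ ↔ μ ∈ convexHull ℝ (configMixtures N d w) := by
  constructor
  · rintro ⟨u, hu, hμ⟩
    refine convexHull_min ?_ (convex_convexHull ℝ _) (majorized_iff_mem_convexHull.1 hμ)
    rintro _ ⟨σ, rfl⟩
    exact comp_perm_mem_convexHull σ (fun v hv => comp_perm_mem_configMixtures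
      (generatingVectors_subset_configMixtures w hv) σ) hu
  · intro h
    refine convexHull_min (fun x hx => ?_) (convex_setOf_exclusionPrinciple hw) h
    refine convexHull_min ?_ (convex_setOf_exclusionPrinciple hw)
      (mem_convexHull_rearrangements hw hx)
    rintro _ ⟨v, hv, σ, rfl⟩
    exact ⟨v, subset_convexHull ℝ _ hv, majorized_comp_perm v σ⟩

end WEnsemble

/-! ### Operators with prescribed spectrum, Schur's theorem and the relaxed ensemble. -/

namespace WEnsemble

variable {N d : ℕ}

theorem roots_charpoly_diagonal {ι : Type*} [Fintype ι] [DecidableEq ι] (a : ι → ℂ) :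
    (Matrix.diagonal a).charpoly.roots = univ.val.map a := by
  rw [Matrix.charpoly_diagonal, ← Polynomial.roots_multiset_prod_X_sub_C (univ.val.map a),
    Multiset.map_map]
  rfl

section

variable {E : Type*} [NormedAddCommGroup E] [InnerProductSpace ℂ E] {ι : Type*} [Fintype ι]
  (b : OrthonormalBasis ι ℂ E)

/-- The operator `∑ j, a j |b j⟩⟨b j|`. -/
noncomputable def mixOp (a : ι → ℝ) : E →ₗ[ℂ] E :=
  ∑ j, ((a j : ℝ) : ℂ) • (InnerProductSpace.rankOne ℂ (b j) (b j) : E →L[ℂ] E).toLinearMap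

theorem mixOp_add (a a' : ι → ℝ) : mixOp b (a + a') = mixOp b a + mixOp b a' := by
  simp [mixOp, add_smul, sum_add_distrib]

theorem mixOp_smul (c : ℝ) (a : ι → ℝ) : mixOp b (c • a) = (c : ℂ) • mixOp b a := by
  simp [mixOp, smul_sum, mul_smul]

theorem mixOp_apply (a : ι → ℝ) (x : E) :
    mixOp b a x = ∑ j, (a j : ℂ) • inner ℂ (b j) x • b j := by
  simp [mixOp, InnerProductSpace.rankOne_apply]

theorem mixOp_apply_basis (a : ι → ℝ) (j : ι) : mixOp b a (b j) = (a j : ℂ) • b j := by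
  classical
  rw [mixOp_apply, sum_eq_single j]
  · simp
  · intro k _ hk
    simp [b.inner_eq_ite, hk]
  · simp

theorem eq_mixOp {Γ : E →ₗ[ℂ] E} {a : ι → ℝ} (h : ∀ j, Γ (b j) = (a j : ℂ) • b j) :
    Γ = mixOp b a := by
  apply b.toBasis.ext
  intro j
  simp [h, mixOp_apply_basis]

theorem mixOp_reindex {κ : Type*} [Fintype κ] (e : ι ≃ κ) (a : κ → ℝ) :
    mixOp (b.reindex e) a = mixOp b (a ∘ e) := by
  apply eq_mixOp
  intro j
  have := mixOp_apply_basis (b.reindex e) a (e j)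
  simpa using this

theorem roots_charpoly_mixOp [FiniteDimensional ℂ E] (a : ι → ℝ) :
    (mixOp b a).charpoly.roots = univ.val.map fun j => (a j : ℂ) := by
  classical
  rw [← LinearMap.charpoly_toMatrix _ b.toBasis]
  have : LinearMap.toMatrix b.toBasis b.toBasis (mixOp b a)
      = Matrix.diagonal fun j => (a j : ℂ) := by
    ext i j
    rw [LinearMap.toMatrix_apply]
    simp only [OrthonormalBasis.coe_toBasis, mixOp_apply_basis, map_smul,
      Matrix.diagonal_apply, Finsupp.smul_apply, OrthonormalBasis.coe_toBasis_repr_apply,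
      OrthonormalBasis.repr_self]
    rcases eq_or_ne i j with rfl | h
    · simp
    · simp [h]
  rw [this, roots_charpoly_diagonal]

theorem isSymmetric_mixOp (a : ι → ℝ) : (mixOp b a).IsSymmetric := by
  intro x y
  simp only [mixOp_apply, inner_sum, sum_inner, inner_smul_left, inner_smul_right,
    Complex.conj_ofReal, inner_conj_symm]
  exact sum_congr rfl fun j _ => by ring

theorem isPositive_mixOp {a : ι → ℝ} (ha : ∀ j, 0 ≤ a j) : (mixOp b a).IsPositive := by
  refine ⟨isSymmetric_mixOp b a, fun x => ?_⟩
  simp only [mixOp_apply, sum_inner, inner_smul_left,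
    Complex.conj_ofReal, map_sum]
  refine sum_nonneg fun j _ => ?_
  rw [mul_comm (starRingEnd ℂ _), Complex.mul_conj, ← Complex.ofReal_mul]
  simpa using mul_nonneg (ha j) (Complex.normSq_nonneg _)

theorem trace_mixOp (a : ι → ℝ) : LinearMap.trace ℂ E (mixOp b a) = ((∑ j, a j : ℝ) : ℂ) := by
  classical
  rw [LinearMap.trace_eq_sum_inner _ b]
  simp only [mixOp_apply_basis, inner_smul_right, Complex.ofReal_sum]
  simp

/-- The diagonal of an operator in an orthonormal basis. -/
noncomputable def basisDiag (Γ : E →ₗ[ℂ] E) : ι → ℝ := fun j => (inner ℂ (b j) (Γ (b j))).re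

theorem basisDiag_add (Γ Γ' : E →ₗ[ℂ] E) :
    basisDiag b (Γ + Γ') = basisDiag b Γ + basisDiag b Γ' := by
  ext; simp [basisDiag]

theorem basisDiag_smul (c : ℝ) (Γ : E →ₗ[ℂ] E) :
    basisDiag b ((c : ℂ) • Γ) = c • basisDiag b Γ := by
  ext; simp [basisDiag]

theorem basisDiag_mixOp (a : ι → ℝ) : basisDiag b (mixOp b a) = a := by
  ext j
  simp only [basisDiag, mixOp_apply_basis, inner_smul_right]
  simp

theorem basisDiag_mixOp_apply {κ : Type*} [Fintype κ] (b' : OrthonormalBasis κ ℂ E) (a : ι → ℝ)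
    (j : κ) : basisDiag b' (mixOp b a) j = ∑ k, a k * ‖inner ℂ (b k) (b' j)‖ ^ 2 := by
  simp only [basisDiag, mixOp_apply, inner_sum, inner_smul_right, Complex.re_sum]
  refine sum_congr rfl fun k _ => ?_
  rw [← inner_conj_symm (b' j) (b k), Complex.mul_conj, Complex.normSq_eq_norm_sq,
    ← Complex.ofReal_mul, Complex.ofReal_re]

/-- Schur: the diagonal of a Hermitian operator is a convex combination of rearrangements of its
eigenvalues. -/
theorem basisDiag_mixOp_mem (b' : OrthonormalBasis ι ℂ E) (a : ι → ℝ) :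
    basisDiag b' (mixOp b a) ∈ convexHull ℝ (Set.range fun σ : Equiv.Perm ι => a ∘ σ) := by
  classical
  -- Squared overlaps of two orthonormal bases: Parseval for each basis gives the row and column
  -- sums.
  let B : Matrix ι ι ℝ := Matrix.of fun j k => ‖inner ℂ (b k) (b' j)‖ ^ 2
  have hB : B ∈ doublyStochastic ℝ ι := by
    rw [mem_doublyStochastic_iff_sum]
    refine ⟨fun i j => by simp [B], fun j => ?_, fun k => ?_⟩
    · simp only [B, Matrix.of_apply, b.sum_sq_norm_inner_right]
      simp
    · simp only [B, Matrix.of_apply, b'.sum_sq_norm_inner_left]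
      simp
  have : basisDiag b' (mixOp b a) = B.mulVec a := by
    ext j
    rw [basisDiag_mixOp_apply]
    exact sum_congr rfl fun k _ => mul_comm _ _
  rw [this]
  exact mulVec_mem_convexHull_of_doublyStochastic hB a

end

/-- `mixOp` as a real linear function of the weights. -/
noncomputable def mixOpLin {ι : Type*} [Fintype ι] (b : OrthonormalBasis ι ℂ (fermionSpace N d)) :
    (ι → ℝ) →ₗ[ℝ] FermionOp N d where
  toFun a := mixOp b a
  map_add' := mixOp_add b
  map_smul' := mixOp_smul b

/-- `basisDiag` as a real linear function of the operator. -/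
noncomputable def basisDiagLin {ι : Type*} [Fintype ι]
    (b : OrthonormalBasis ι ℂ (fermionSpace N d)) : FermionOp N d →ₗ[ℝ] (ι → ℝ) where
  toFun Γ := basisDiag b Γ
  map_add' := basisDiag_add b
  map_smul' := basisDiag_smul b

/-- Equal multisets have fibres of equal size; bijections between the fibres glue to a permutation.
-/
theorem exists_perm_of_map_eq {m : ℕ} {u v : Fin m → ℝ}
    (h : (univ.val.map fun j => (u j : ℂ)) = univ.val.map fun j => (v j : ℂ)) :
    ∃ σ : Equiv.Perm (Fin m), u = v ∘ σ := by
  have h' : univ.val.map u = univ.val.map v := by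
    have := congrArg (Multiset.map Complex.re) h
    simpa [Multiset.map_map, Function.comp_def] using this
  have hcard (x : ℝ) : Fintype.card {i // u i = x} = Fintype.card {i // v i = x} := by
    have := congrArg (Multiset.count x) h'
    rw [Multiset.count_map, Multiset.count_map] at this
    rw [Fintype.card_subtype, Fintype.card_subtype]
    simpa [Finset.card_def, eq_comm] using this
  let e : Fin m ≃ Fin m := ((Equiv.sigmaFiberEquiv u).symm.trans
    (Equiv.sigmaCongrRight fun x => Fintype.equivOfCardEq (hcard x))).trans
    (Equiv.sigmaFiberEquiv v)
  refine ⟨e, funext fun i => ?_⟩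
  exact (Fintype.equivOfCardEq (hcard (u i)) ⟨i, rfl⟩).2.symm

theorem exists_eq_mixOp (hfin : Module.finrank ℂ (fermionSpace N d) = d.choose N)
    {Γ : FermionOp N d} (hΓ : HermitianOp Γ) :
    ∃ (b : OrthonormalBasis (Fin (d.choose N)) ℂ (fermionSpace N d)) (a : Fin (d.choose N) → ℝ),
      Γ = mixOp b a :=
  ⟨hΓ.eigenvectorBasis hfin, hΓ.eigenvalues hfin,
    eq_mixOp (E := fermionSpace N d) _ fun j => hΓ.apply_eigenvectorBasis hfin j⟩

theorem exists_eq_mixOp_of_hasSpectrum (hfin : Module.finrank ℂ (fermionSpace N d) = d.choose N)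
    {Γ : FermionOp N d} (hΓ : HermitianOp Γ) {w : Fin (d.choose N) → ℝ} (hw : OpHasSpectrum Γ w) :
    ∃ b : OrthonormalBasis (Fin (d.choose N)) ℂ (fermionSpace N d), Γ = mixOp b w := by
  obtain ⟨b, a, rfl⟩ := exists_eq_mixOp hfin hΓ
  obtain ⟨σ, rfl⟩ := exists_perm_of_map_eq ((roots_charpoly_mixOp b a).symm.trans hw)
  exact ⟨b.reindex σ, (mixOp_reindex b σ w).symm⟩

variable {w : Fin (d.choose N) → ℝ}

theorem mixOp_mem_ensN (w_nonneg : ∀ j, 0 ≤ w j) (w_sum : ∑ j, w j = 1)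
    (b : OrthonormalBasis (Fin (d.choose N)) ℂ (fermionSpace N d)) : mixOp b w ∈ ensN N d w :=
  ⟨⟨isPositive_mixOp b w_nonneg, (trace_mixOp b w).trans (by rw [w_sum, Complex.ofReal_one])⟩,
    roots_charpoly_mixOp b w⟩

/-- By the spectral theorem only the orthonormal basis varies over the ensemble, while the weights
stay fixed. -/
theorem ensN_eq_range (hfin : Module.finrank ℂ (fermionSpace N d) = d.choose N)
    (w_nonneg : ∀ j, 0 ≤ w j) (w_sum : ∑ j, w j = 1) :
    ensN N d w = Set.range fun b : OrthonormalBasis (Fin (d.choose N)) ℂ (fermionSpace N d) =>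
      mixOp b w := by
  ext Γ
  constructor
  · rintro ⟨h1, h2⟩
    obtain ⟨b, rfl⟩ := exists_eq_mixOp_of_hasSpectrum hfin h1.1.isSymmetric h2
    exact ⟨b, rfl⟩
  · rintro ⟨b, rfl⟩
    exact mixOp_mem_ensN w_nonneg w_sum b

theorem convex_densityOps : Convex ℝ (densityOps N d) := by
  rintro x ⟨hx, hx'⟩ y ⟨hy, hy'⟩ a b ha hb hab
  have h (c : ℝ) (z : FermionOp N d) : c • z = (c : ℂ) • z := rfl
  refine ⟨?_, ?_⟩
  · rw [h, h]
    exact (hx.smul_of_nonneg (by simpa using ha)).add (hy.smul_of_nonneg (by simpa using hb))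
  · rw [h, h, map_add, map_smul, map_smul, hx', hy', ← add_smul, ← Complex.ofReal_add, hab]
    simp

/-- Forward: in an eigenbasis of Γ, taking the diagonal is linear, returns the spectrum of Γ, and
sends the ensemble into the hull of rearrangements of `w` by Schur. Backward: with the eigenbasis
fixed, Rado's theorem decomposes the spectrum, and rearranging weights amounts to reindexing the
basis. -/
theorem mem_relaxedEnsN_iff (hfin : Module.finrank ℂ (fermionSpace N d) = d.choose N)
    (w_nonneg : ∀ j, 0 ≤ w j) (w_sum : ∑ j, w j = 1) {Γ : FermionOp N d} :
    Γ ∈ relaxedEnsN N d w ↔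
      Γ ∈ densityOps N d ∧ ∃ w', OpHasSpectrum Γ w' ∧ Majorized w' w := by
  constructor
  · intro h
    have hd : Γ ∈ densityOps N d := convexHull_min (fun _ h => h.1) convex_densityOps h
    refine ⟨hd, ?_⟩
    obtain ⟨b, a, rfl⟩ := exists_eq_mixOp hfin hd.1.isSymmetric
    refine ⟨a, roots_charpoly_mixOp b a, majorized_iff_mem_convexHull.2 ?_⟩
    have h1 : basisDiag b (mixOp b a) ∈ basisDiagLin b '' convexHull ℝ (ensN N d w) := ⟨_, h, rfl⟩
    rw [LinearMap.image_convexHull, basisDiag_mixOp] at h1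
    refine convexHull_min ?_ (convex_convexHull ℝ _) h1
    rw [ensN_eq_range hfin w_nonneg w_sum]
    rintro _ ⟨_, ⟨b', rfl⟩, rfl⟩
    exact basisDiag_mixOp_mem b' b w
  · rintro ⟨hd, w', hw', hmaj⟩
    obtain ⟨b, rfl⟩ := exists_eq_mixOp_of_hasSpectrum hfin hd.1.isSymmetric hw'
    have h1 : mixOp b w' ∈ mixOpLin b '' convexHull ℝ _ :=
      ⟨w', majorized_iff_mem_convexHull.1 hmaj, rfl⟩
    rw [LinearMap.image_convexHull] at h1
    refine convexHull_mono ?_ h1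
    rintro _ ⟨_, ⟨σ, rfl⟩, rfl⟩
    have := mixOp_mem_ensN w_nonneg w_sum (b.reindex σ)
    rwa [mixOp_reindex] at this

end WEnsemble

namespace WEnsemble

variable {N d n : ℕ}

/-! ### Slater determinants -/

/-- The increasing enumeration of a configuration. -/
def configTuple (s : Config N d) : Fin N → Fin d := s.val.orderEmbOfFin s.2

theorem configTuple_injective (s : Config N d) : Function.Injective (configTuple s) :=
  (s.val.orderEmbOfFin s.2).injective

theorem range_configTuple (s : Config N d) : Set.range (configTuple s) = s.val :=
  s.val.range_orderEmbOfFin s.2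

theorem range_configTuple_comp (s : Config N d) (σ : Equiv.Perm (Fin N)) :
    Set.range (configTuple s ∘ σ) = s.val := by
  rw [EquivLike.range_comp, range_configTuple]

theorem configTuple_comp_injective :
    Function.Injective fun p : Config N d × Equiv.Perm (Fin N) => configTuple p.1 ∘ p.2 := by
  rintro ⟨s, σ⟩ ⟨t, τ⟩ h
  have hst : s = t := by
    have := congrArg Set.range h
    dsimp only at this
    rw [range_configTuple_comp, range_configTuple_comp] at this
    exact Subtype.ext (coe_injective this)
  subst hst
  have : σ = τ := Equiv.ext fun i => configTuple_injective s (congrFun h i)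
  rw [this]

theorem exists_eq_configTuple_comp {x : Fin N → Fin d} (hx : Function.Injective x) :
    ∃ (s : Config N d) (σ : Equiv.Perm (Fin N)), x = configTuple s ∘ σ := by
  let s : Config N d := ⟨univ.map ⟨x, hx⟩, by simp⟩
  have h (i) : ∃ j, configTuple s j = x i := by
    have : x i ∈ Set.range (configTuple s) := by
      rw [range_configTuple]
      simp [s]
    exact this
  choose f hf using h
  have hinj : Function.Injective f := fun i j hij => hx (by rw [← hf i, ← hf j, hij])
  exact ⟨s, Equiv.ofBijective f (Finite.injective_iff_bijective.1 hinj), funext fun i => (hf i).symm⟩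

/-- Sums over tuples of sites without repetition are sums over configurations and orderings. -/
theorem sum_eq_sum_config {M : Type*} [AddCommMonoid M] {F : (Fin N → Fin d) → M}
    (hF : ∀ x, ¬ Function.Injective x → F x = 0) :
    ∑ x, F x = ∑ s : Config N d, ∑ σ : Equiv.Perm (Fin N), F (configTuple s ∘ σ) := by
  rw [← Fintype.sum_prod_type'
    fun (s : Config N d) (σ : Equiv.Perm (Fin N)) => F (configTuple s ∘ σ)]
  refine (Fintype.sum_of_injective _ configTuple_comp_injective _ _ (fun x hx => hF x ?_)
    fun p => rfl).symm
  intro hinj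
  obtain ⟨s, σ, rfl⟩ := exists_eq_configTuple_comp hinj
  exact hx ⟨(s, σ), rfl⟩

theorem fermion_apply_comp (ψ : fermionSpace N d) (x : Fin N → Fin d) (σ : Equiv.Perm (Fin N)) :
    ψ.val (x ∘ σ) = ((Equiv.Perm.sign σ : ℤ) : ℂ) * ψ.val x := ψ.2 σ x

theorem fermion_eq_zero (ψ : fermionSpace N d) {x : Fin N → Fin d} (hx : ¬ Function.Injective x) :
    ψ.val x = 0 := by
  simp only [Function.Injective, not_forall] at hx
  obtain ⟨i, j, hij, hne⟩ := hx
  have h1 := fermion_apply_comp ψ x (Equiv.swap i j)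
  have h2 : x ∘ Equiv.swap i j = x := by
    funext k
    rcases eq_or_ne k i with rfl | hki
    · simp [hij]
    rcases eq_or_ne k j with rfl | hkj
    · simp [hij]
    simp [Equiv.swap_apply_of_ne_of_ne hki hkj]
  rw [h2, Equiv.Perm.sign_swap hne] at h1
  have h3 : ψ.val x = -ψ.val x := by simpa using h1
  exact self_eq_neg.1 h3

theorem norm_fermion_comp (ψ : fermionSpace N d) (x : Fin N → Fin d) (σ : Equiv.Perm (Fin N)) :
    ‖ψ.val (x ∘ σ)‖ = ‖ψ.val x‖ := by
  rw [fermion_apply_comp, norm_mul]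
  rcases Int.units_eq_one_or (Equiv.Perm.sign σ) with h | h <;> simp [h]

/-- The coefficients of a wave function with respect to the Slater determinants. -/
noncomputable def slaterCoeff (N d : ℕ) : fermionSpace N d →ₗᵢ[ℂ] EuclideanSpace ℂ (Config N d) where
  -- Each configuration has `N!` orderings, on all of which ψ has the same modulus; the square root
  -- makes the map isometric.
  toFun ψ := WithLp.toLp 2 fun s => (Real.sqrt N.factorial : ℂ) * ψ.val (configTuple s)
  map_add' ψ φ := by ext s; simp [mul_add]
  map_smul' c ψ := by ext s; simp [mul_left_comm]
  norm_map' ψ := by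
    have h1 : ‖ψ‖ = ‖ψ.val‖ := rfl
    rw [h1, EuclideanSpace.norm_eq, EuclideanSpace.norm_eq]
    congr 1
    rw [sum_eq_sum_config (F := fun x => ‖ψ.val x‖ ^ 2)
      fun x hx => by simp [fermion_eq_zero ψ hx]]
    refine sum_congr rfl fun s _ => ?_
    simp [norm_fermion_comp, mul_pow, Fintype.card_perm]

theorem slaterCoeff_apply (ψ : fermionSpace N d) (s : Config N d) :
    slaterCoeff N d ψ s = (Real.sqrt N.factorial : ℂ) * ψ.val (configTuple s) := rfl

theorem slaterCoeff_surjective : Function.Surjective (slaterCoeff N d) := by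
  classical
  intro a
  -- The antisymmetric extension of the prescribed coefficients: at most one pair `(s, σ)`
  -- contributes at each `x`.
  let f : TensorSpace N d := WithLp.toLp 2 fun x =>
    ∑ s : Config N d, ∑ σ : Equiv.Perm (Fin N),
      if configTuple s ∘ σ = x then
        ((Equiv.Perm.sign σ : ℤ) : ℂ) * (a s / (Real.sqrt N.factorial : ℂ)) else 0
  have hf : f ∈ fermionSpace N d := by
    intro τ x
    simp only [f, mul_sum]
    refine sum_congr rfl fun s _ => ?_
    rw [← Equiv.sum_comp (Equiv.mulRight τ)]
    refine sum_congr rfl fun σ _ => ?_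
    have : (configTuple s ∘ (σ * τ : Equiv.Perm (Fin N)) = x ∘ τ) ↔ configTuple s ∘ σ = x := by
      rw [Equiv.Perm.coe_mul, ← Function.comp_assoc]
      exact (τ.surjective.injective_comp_right).eq_iff
    simp only [Equiv.coe_mulRight, this]
    split_ifs
    · rw [Equiv.Perm.sign_mul]
      push_cast
      ring
    · simp
  refine ⟨⟨f, hf⟩, ?_⟩
  ext t
  rw [slaterCoeff_apply]
  have h0 : (Real.sqrt N.factorial : ℂ) ≠ 0 := by
    have : Real.sqrt N.factorial ≠ 0 := (Real.sqrt_pos.2 (by positivity)).ne'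
    exact_mod_cast this
  have h1 : f (configTuple t) = a t / (Real.sqrt N.factorial : ℂ) := by
    simp only [f]
    rw [← Fintype.sum_prod_type' fun (s : Config N d) (σ : Equiv.Perm (Fin N)) =>
      if configTuple s ∘ σ = configTuple t then
        ((Equiv.Perm.sign σ : ℤ) : ℂ) * (a s / (Real.sqrt N.factorial : ℂ)) else 0]
    rw [Fintype.sum_eq_single (t, 1)]
    · simp
    · intro p hp
      refine if_neg fun h => hp ?_
      exact configTuple_comp_injective (a₁ := p) (a₂ := (t, 1)) (by simpa using h)
  rw [show (⟨f, hf⟩ : fermionSpace N d).val = f from rfl, h1]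
  field_simp

/-- The orthonormal basis of Slater determinants of lattice site states. -/
noncomputable def slaterBasis (N d : ℕ) : OrthonormalBasis (Config N d) ℂ (fermionSpace N d) :=
  OrthonormalBasis.ofRepr (LinearIsometryEquiv.ofSurjective _ slaterCoeff_surjective)

theorem inner_slaterBasis (s : Config N d) (ψ : fermionSpace N d) :
    inner ℂ (slaterBasis N d s) ψ = (Real.sqrt N.factorial : ℂ) * ψ.val (configTuple s) :=
  ((slaterBasis N d).repr_apply_apply ψ s).symm

theorem card_config (N d : ℕ) : Fintype.card (Config N d) = d.choose N := by
  simp [Config]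

theorem finrank_fermionSpace (N d : ℕ) : Module.finrank ℂ (fermionSpace N d) = d.choose N := by
  rw [← card_config]
  exact Module.finrank_eq_card_basis (slaterBasis N d).toBasis

/-- A value at an ordering of another configuration `t` would be, up to sign and normalization, the
inner product with the Slater determinant of `t`, which is zero. -/
theorem slaterBasis_ne_zero {s : Config N d} {x : Fin N → Fin d}
    (h : (slaterBasis N d s).val x ≠ 0) : Function.Injective x ∧ Set.range x = s.val := by
  have hx : Function.Injective x := by
    by_contra hx
    exact h (fermion_eq_zero _ hx)
  refine ⟨hx, ?_⟩
  obtain ⟨t, σ, rfl⟩ := exists_eq_configTuple_comp hx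
  rw [range_configTuple_comp]
  by_contra hne
  apply h
  rw [fermion_apply_comp]
  have h1 := inner_slaterBasis t (slaterBasis N d s)
  have h2 : inner ℂ (slaterBasis N d t) (slaterBasis N d s) = 0 :=
    (slaterBasis N d).orthonormal.2 fun hts => hne (by rw [hts])
  rw [h2, eq_comm, mul_eq_zero] at h1
  rcases h1 with h1 | h1
  · have : Real.sqrt N.factorial ≠ 0 := (Real.sqrt_pos.2 (by positivity)).ne'
    exact absurd h1 (by exact_mod_cast this)
  · rw [h1, mul_zero]

/-! ### Reduced density matrices of mixtures -/

/-- The one-particle reduced density matrix of a pure state. -/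
noncomputable def pureRDM (ψ : TensorSpace (n + 1) d) : Matrix (Fin d) (Fin d) ℂ :=
  Matrix.of fun i j => ((n + 1 : ℕ) : ℂ) * ∑ x : Fin n → Fin d,
    ψ (Fin.cons i x : Fin (n + 1) → Fin d) * star (ψ (Fin.cons j x : Fin (n + 1) → Fin d))

theorem matrixElement_mixOp {ι : Type*} [Fintype ι] (b : OrthonormalBasis ι ℂ (fermionSpace N d))
    (a : ι → ℝ) (x y : Fin N → Fin d) :
    matrixElement (mixOp b a) x y = ∑ k, (a k : ℂ) * ((b k).val x * star ((b k).val y)) := by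
  have h1 : matrixElement (mixOp b a) x y = (mixOp b a ((fermionSpace N d).orthogonalProjectionOnto
      (EuclideanSpace.single y 1))).val x := rfl
  have h2 := mixOp_apply b a ((fermionSpace N d).orthogonalProjectionOnto
      (EuclideanSpace.single y 1))
  rw [h1, h2]
  have h3 (f : ι → fermionSpace N d) : (∑ k, f k).val x = ∑ k, (f k).val x := by
    simp
  refine (h3 _).trans (sum_congr rfl fun k _ => ?_)
  have h4 : inner ℂ (b k) ((fermionSpace N d).orthogonalProjectionOnto (EuclideanSpace.single y 1))
      = star ((b k).val y) := by
    rw [Submodule.inner_orthogonalProjectionOnto_eq_of_mem_left]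
    simp [EuclideanSpace.inner_single_right]
  rw [h4]
  have h5 : ((a k : ℂ) • star ((b k).val y) • b k).val x
    = (a k : ℂ) * (star ((b k).val y) * (b k).val x) := rfl
  refine h5.trans (by ring)

theorem oneRDM_mixOp {ι : Type*} [Fintype ι] (b : OrthonormalBasis ι ℂ (fermionSpace (n + 1) d))
    (a : ι → ℝ) : oneRDM (mixOp b a) = ∑ k, (a k : ℂ) • pureRDM (b k).val := by
  ext i j
  simp only [oneRDM, matrixElement_mixOp, pureRDM, Matrix.of_apply, Matrix.sum_apply,
    Matrix.smul_apply, smul_eq_mul, mul_sum]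
  rw [sum_comm]
  exact sum_congr rfl fun k _ => sum_congr rfl fun x _ => by ring

theorem isHermitian_pureRDM (ψ : TensorSpace (n + 1) d) : (pureRDM ψ).IsHermitian := by
  ext i j
  simp [pureRDM, Matrix.conjTranspose_apply, mul_comm]

/-- Summing a symmetric function over all arguments but one, fixed at the site `i`, counts the
arguments at `i`. -/
theorem card_mul_sum_cons (F : (Fin (n + 1) → Fin d) → ℝ)
    (hF : ∀ x (σ : Equiv.Perm (Fin (n + 1))), F (x ∘ σ) = F x) (i : Fin d) :
    ((n + 1 : ℕ) : ℝ) * ∑ x : Fin n → Fin d, F (Fin.cons i x : Fin (n + 1) → Fin d) =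
      ∑ x, (∑ k, if x k = i then 1 else 0) * F x := by
  -- By symmetry the argument `k` can be exchanged with the first, so all `n + 1` positions
  -- contribute equally.
  have h1 (k : Fin (n + 1)) : ∑ x : Fin (n + 1) → Fin d, (if x k = i then 1 else 0) * F x =
      ∑ x : Fin n → Fin d, F (Fin.cons i x : Fin (n + 1) → Fin d) := by
    rw [← Equiv.sum_comp (Equiv.arrowCongr (Equiv.swap 0 k) (Equiv.refl (Fin d)))]
    rw [← Equiv.sum_comp (Fin.consEquiv fun _ : Fin (n + 1) => Fin d), Fintype.sum_prod_type]
    rw [Fintype.sum_eq_single i]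
    · refine sum_congr rfl fun x _ => ?_
      have h2 := hF (Fin.cons i x : Fin (n + 1) → Fin d) (Equiv.swap 0 k)
      simp only [Equiv.arrowCongr, Equiv.coe_fn_mk, Equiv.symm_swap, Equiv.coe_refl,
        Function.id_comp, Fin.consEquiv]
      rw [h2]
      simp
    · intro j hj
      refine sum_eq_zero fun x _ => ?_
      simp [Equiv.arrowCongr, Fin.consEquiv, hj]
  simp_rw [sum_mul]
  rw [sum_comm, sum_congr rfl fun k _ => h1 k]
  simp

/-- The operator counting particles at a site is diagonal in the Slater basis, so only the squared
moduli of the coefficients enter. -/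
theorem pureRDM_apply_self (ψ : fermionSpace (n + 1) d) (i : Fin d) :
    pureRDM ψ.val i i = ((∑ s : Config (n + 1) d,
      ‖inner ℂ (slaterBasis (n + 1) d s) ψ‖ ^ 2 * occVec s i : ℝ) : ℂ) := by
  have h1 := card_mul_sum_cons (fun x => ‖ψ.val x‖ ^ 2)
    (fun x σ => by rw [norm_fermion_comp]) i
  rw [sum_eq_sum_config
    (F := fun x => (∑ k, if x k = i then (1 : ℝ) else 0) * ‖ψ.val x‖ ^ 2)
    fun x hx => by simp [fermion_eq_zero ψ hx]] at h1
  have h2 : pureRDM ψ.val i i = ((((n + 1 : ℕ) : ℝ) * ∑ x : Fin n → Fin d,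
      ‖ψ.val (Fin.cons i x : Fin (n + 1) → Fin d)‖ ^ 2 : ℝ) : ℂ) := by
    simp only [pureRDM, Matrix.of_apply]
    push_cast
    congr 1
    refine sum_congr rfl fun x _ => ?_
    exact Complex.mul_conj' _
  rw [h2, h1]
  congr 1
  refine sum_congr rfl fun s _ => ?_
  have h3 (σ : Equiv.Perm (Fin (n + 1))) :
      (∑ k, if (configTuple s ∘ σ) k = i then (1 : ℝ) else 0) = occVec s i := by
    simp only [Function.comp_apply]
    rw [Equiv.sum_comp σ fun k => if configTuple s k = i then (1 : ℝ) else 0]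
    have hm : i ∈ s.val ↔ ∃ k, configTuple s k = i := by
      rw [← mem_coe, ← range_configTuple, Set.mem_range]
    by_cases hi : i ∈ s.val
    · obtain ⟨k, rfl⟩ := hm.1 hi
      simp [occVec, hi, (configTuple_injective s).eq_iff]
    · have : ∀ k, configTuple s k ≠ i := fun k hk => hi (hm.2 ⟨k, hk⟩)
      simp [occVec, hi, this]
  simp only [h3, norm_fermion_comp, inner_slaterBasis, norm_mul, mul_pow, sum_const, card_univ,
    Fintype.card_perm, Fintype.card_fin]
  rw [Complex.norm_real, Real.norm_eq_abs, sq_abs, Real.sq_sqrt (by positivity)]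
  simp
  ring

theorem pureRDM_slaterBasis (s : Config (n + 1) d) :
    pureRDM (slaterBasis (n + 1) d s).val = Matrix.diagonal fun i => (occVec s i : ℂ) := by
  ext i j
  rcases eq_or_ne i j with rfl | hij
  · rw [pureRDM_apply_self, Matrix.diagonal_apply_eq, Fintype.sum_eq_single s]
    · have : inner ℂ (slaterBasis (n + 1) d s) (slaterBasis (n + 1) d s) = 1 := by
        rw [(slaterBasis (n + 1) d).inner_eq_ite, if_pos rfl]
      rw [this]
      simp
    · intro t ht
      have : inner ℂ (slaterBasis (n + 1) d t) (slaterBasis (n + 1) d s) = 0 :=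
        (slaterBasis (n + 1) d).orthonormal.2 ht
      rw [this]
      simp
  · rw [Matrix.diagonal_apply_ne _ hij]
    simp only [pureRDM, Matrix.of_apply]
    rw [sum_eq_zero, mul_zero]
    intro x _
    by_contra hne
    -- A nonzero off-diagonal term requires two tuples that differ only in their first entry and
    -- enumerate the same set without repetition, which is impossible.
    obtain ⟨h1, h2⟩ := slaterBasis_ne_zero (left_ne_zero_of_mul hne)
    obtain ⟨-, h4⟩ := slaterBasis_ne_zero (star_ne_zero.1 (right_ne_zero_of_mul hne))
    rw [← h4, Fin.range_cons, Fin.range_cons] at h2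
    have h5 : i ∈ insert j (Set.range x) := h2 ▸ Set.mem_insert i _
    rcases h5 with h5 | ⟨k, hk⟩
    · exact hij h5
    · have := h1 (a₁ := k.succ) (a₂ := 0) (by simpa using hk)
      exact Fin.succ_ne_zero k this

end WEnsemble

namespace WEnsemble

variable {N d n : ℕ}

/-! ### Covariance under unitary transformations of the one-particle space -/

/-- The `N`-fold Kronecker power of a matrix. -/
def kroneckerPow (N : ℕ) (U : Matrix (Fin d) (Fin d) ℂ) :
    Matrix (Fin N → Fin d) (Fin N → Fin d) ℂ :=
  Matrix.of fun x y => ∏ k, U (x k) (y k)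

theorem kroneckerPow_mul (U V : Matrix (Fin d) (Fin d) ℂ) :
    kroneckerPow N (U * V) = kroneckerPow N U * kroneckerPow N V := by
  ext x y
  simp only [kroneckerPow, Matrix.of_apply, Matrix.mul_apply, ← prod_mul_distrib]
  rw [prod_univ_sum, Fintype.piFinset_univ]

theorem kroneckerPow_one : kroneckerPow N (1 : Matrix (Fin d) (Fin d) ℂ) = 1 := by
  ext x y
  simp only [kroneckerPow, Matrix.of_apply, Matrix.one_apply]
  rcases eq_or_ne x y with rfl | hxy
  · simp
  · obtain ⟨k, hk⟩ := Function.ne_iff.1 hxy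
    rw [if_neg hxy, prod_eq_zero (mem_univ k) (if_neg hk)]

theorem conjTranspose_kroneckerPow (U : Matrix (Fin d) (Fin d) ℂ) :
    (kroneckerPow N U).conjTranspose = kroneckerPow N U.conjTranspose := by
  ext x y
  simp [kroneckerPow, Matrix.conjTranspose_apply]

/-- The action of a one-particle operator `U` on the `N`-fermion space as `U ⊗ ⋯ ⊗ U`. -/
noncomputable def fermionAction (N : ℕ) (U : Matrix (Fin d) (Fin d) ℂ) :
    fermionSpace N d →ₗ[ℂ] fermionSpace N d where
  toFun ψ := ⟨WithLp.toLp 2 ((kroneckerPow N U).mulVec ψ.val), by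
    intro σ x
    simp only [Matrix.mulVec, dotProduct, mul_sum]
    rw [← Equiv.sum_comp (Equiv.arrowCongr σ.symm (Equiv.refl (Fin d)))]
    refine sum_congr rfl fun y _ => ?_
    have h1 : Equiv.arrowCongr σ.symm (Equiv.refl (Fin d)) y = y ∘ σ := rfl
    have h2 : kroneckerPow N U (x ∘ σ) (y ∘ σ) = kroneckerPow N U x y :=
      Equiv.prod_comp σ fun k => U (x k) (y k)
    rw [h1, h2, fermion_apply_comp]
    ring⟩
  map_add' ψ φ := by
    apply Subtype.ext
    ext x
    simp [Matrix.mulVec_add]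
  map_smul' c ψ := by
    apply Subtype.ext
    ext x
    simp [Matrix.mulVec_smul]

theorem fermionAction_apply (U : Matrix (Fin d) (Fin d) ℂ) (ψ : fermionSpace N d)
    (x : Fin N → Fin d) :
    (fermionAction N U ψ).val x = ∑ y, kroneckerPow N U x y * ψ.val y := rfl

theorem norm_fermionAction {U : Matrix (Fin d) (Fin d) ℂ} (hU : U.conjTranspose * U = 1)
    (ψ : fermionSpace N d) : ‖fermionAction N U ψ‖ = ‖ψ‖ := by
  have key : (inner ℂ (fermionAction N U ψ).val (fermionAction N U ψ).val : ℂ) =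
      inner ℂ ψ.val ψ.val := by
    rw [EuclideanSpace.inner_eq_star_dotProduct, EuclideanSpace.inner_eq_star_dotProduct]
    change (kroneckerPow N U).mulVec ψ.val ⬝ᵥ star ((kroneckerPow N U).mulVec ψ.val) = _
    rw [dotProduct_comm, Matrix.star_mulVec, Matrix.dotProduct_mulVec, Matrix.vecMul_vecMul,
      conjTranspose_kroneckerPow, ← kroneckerPow_mul, hU, kroneckerPow_one, Matrix.vecMul_one,
      dotProduct_comm]
  rw [inner_self_eq_norm_sq_to_K, inner_self_eq_norm_sq_to_K] at key
  have h2 : ‖(fermionAction N U ψ).val‖ ^ 2 = ‖ψ.val‖ ^ 2 := by exact_mod_cast key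
  exact (sq_eq_sq₀ (norm_nonneg _) (norm_nonneg _)).1 h2

theorem fermionAction_surjective {U : Matrix (Fin d) (Fin d) ℂ} (hU : U * U.conjTranspose = 1) :
    Function.Surjective (fermionAction N U) := by
  intro ψ
  refine ⟨fermionAction N U.conjTranspose ψ, ?_⟩
  apply Subtype.ext
  change WithLp.toLp 2 ((kroneckerPow N U).mulVec ((kroneckerPow N U.conjTranspose).mulVec ψ.val))
    = ψ.val
  rw [Matrix.mulVec_mulVec, ← kroneckerPow_mul, hU, kroneckerPow_one, Matrix.one_mulVec]

/-- The unitary transformation `U ⊗ ⋯ ⊗ U` of the `N`-fermion space. -/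
noncomputable def fermionUnitary (N : ℕ) (U : Matrix (Fin d) (Fin d) ℂ)
    (hU : U * U.conjTranspose = 1) :
    fermionSpace N d ≃ₗᵢ[ℂ] fermionSpace N d :=
  LinearIsometryEquiv.ofSurjective
    ⟨fermionAction N U, norm_fermionAction (mul_eq_one_comm.1 hU)⟩
    (fermionAction_surjective hU)

theorem pureRDM_eq_mul (ψ : TensorSpace (n + 1) d) :
    pureRDM ψ = ((n + 1 : ℕ) : ℂ) •
      ((Matrix.of fun i (x : Fin n → Fin d) => ψ (Fin.cons i x : Fin (n + 1) → Fin d)) *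
      (Matrix.of fun i (x : Fin n → Fin d) =>
        ψ (Fin.cons i x : Fin (n + 1) → Fin d)).conjTranspose) := by
  ext i j
  simp [pureRDM, Matrix.mul_apply]

/-- View ψ as a matrix `A` with the first particle as row and the others as column. The action
multiplies `A` by `U` on the left and by a unitary on the right, and the latter cancels in `A` times
its adjoint. -/
theorem pureRDM_fermionAction {U : Matrix (Fin d) (Fin d) ℂ} (hU : U.conjTranspose * U = 1)
    (ψ : fermionSpace (n + 1) d) :
    pureRDM (fermionAction (n + 1) U ψ).val = U * pureRDM ψ.val * U.conjTranspose := by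
  set A : Matrix (Fin d) (Fin n → Fin d) ℂ :=
    Matrix.of fun i x => ψ.val (Fin.cons i x : Fin (n + 1) → Fin d) with hA
  have h1 : (Matrix.of fun i (x : Fin n → Fin d) =>
      (fermionAction (n + 1) U ψ).val (Fin.cons i x : Fin (n + 1) → Fin d)) =
      U * A * (kroneckerPow n U).transpose := by
    ext i x
    rw [Matrix.of_apply, fermionAction_apply,
      ← Equiv.sum_comp (Fin.consEquiv fun _ : Fin (n + 1) => Fin d), Fintype.sum_prod_type, sum_comm]
    simp only [Matrix.mul_apply, Matrix.transpose_apply, sum_mul]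
    refine sum_congr rfl fun y _ => sum_congr rfl fun j _ => ?_
    simp only [kroneckerPow, Matrix.of_apply, Fin.consEquiv, Equiv.coe_fn_mk, Fin.prod_univ_succ,
      Fin.cons_zero, Fin.cons_succ, hA]
    ring
  have h2 : (kroneckerPow n U).transpose * (kroneckerPow n U).transpose.conjTranspose = 1 := by
    have h3 : (kroneckerPow n U).transpose.conjTranspose =
      (kroneckerPow n U).conjTranspose.transpose := rfl
    rw [h3, ← Matrix.transpose_mul, conjTranspose_kroneckerPow,
      ← kroneckerPow_mul, hU, kroneckerPow_one, Matrix.transpose_one]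
  rw [pureRDM_eq_mul, pureRDM_eq_mul, h1, ← hA, Matrix.mul_smul, Matrix.smul_mul]
  congr 1
  rw [Matrix.conjTranspose_mul, Matrix.conjTranspose_mul, Matrix.mul_assoc (U * A),
    ← Matrix.mul_assoc _ _ (A.conjTranspose * U.conjTranspose), h2, Matrix.one_mul]
  simp only [Matrix.mul_assoc]

theorem oneRDM_mixOp_map {ι : Type*} [Fintype ι]
    (b : OrthonormalBasis ι ℂ (fermionSpace (n + 1) d)) (a : ι → ℝ)
    {U : Matrix (Fin d) (Fin d) ℂ} (hU : U * U.conjTranspose = 1) :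
    oneRDM (mixOp (E := fermionSpace (n + 1) d) (b.map (fermionUnitary (n + 1) U hU)) a) =
      U * oneRDM (mixOp b a) * U.conjTranspose := by
  rw [oneRDM_mixOp, oneRDM_mixOp, mul_sum, sum_mul]
  refine sum_congr rfl fun k _ => ?_
  rw [Matrix.mul_smul, Matrix.smul_mul, ← pureRDM_fermionAction (mul_eq_one_comm.1 hU)]
  rfl

/-! ### Representability -/

variable {w : Fin (d.choose (n + 1)) → ℝ}

theorem ens1_eq_range (w_nonneg : ∀ j, 0 ≤ w j) (w_sum : ∑ j, w j = 1) :
    ens1 n d w = Set.range fun b : OrthonormalBasis (Fin (d.choose (n + 1))) ℂ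
      (fermionSpace (n + 1) d) => oneRDM (mixOp b w) := by
  rw [ens1, ensN_eq_range (finrank_fermionSpace _ _) w_nonneg w_sum, ← Set.range_comp]
  rfl

theorem conj_mem_relaxedEns1 (w_nonneg : ∀ j, 0 ≤ w j) (w_sum : ∑ j, w j = 1)
    {γ U : Matrix (Fin d) (Fin d) ℂ} (hU : U * U.conjTranspose = 1) (hγ : γ ∈ relaxedEns1 n d w) :
    U * γ * U.conjTranspose ∈ relaxedEns1 n d w := by
  have h1 : U * γ * U.conjTranspose ∈
      (LinearMap.mulRight ℝ U.conjTranspose ∘ₗ LinearMap.mulLeft ℝ U) '' convexHull ℝ (ens1 n d w) :=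
    ⟨γ, hγ, rfl⟩
  rw [LinearMap.image_convexHull] at h1
  refine convexHull_mono ?_ h1
  rw [ens1_eq_range w_nonneg w_sum]
  rintro _ ⟨_, ⟨b, rfl⟩, rfl⟩
  exact ⟨b.map (fermionUnitary (n + 1) U hU), oneRDM_mixOp_map b w hU⟩

theorem isHermitian_of_mem_relaxedEns1 (w_nonneg : ∀ j, 0 ≤ w j) (w_sum : ∑ j, w j = 1)
    {γ : Matrix (Fin d) (Fin d) ℂ} (hγ : γ ∈ relaxedEns1 n d w) : γ.IsHermitian := by
  refine convexHull_min (t := {γ | γ.IsHermitian}) ?_ ?_ hγ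
  · rw [ens1_eq_range w_nonneg w_sum]
    rintro _ ⟨b, rfl⟩
    dsimp only
    rw [oneRDM_mixOp]
    change Matrix.conjTranspose _ = _
    rw [Matrix.conjTranspose_sum]
    refine sum_congr rfl fun k _ => ?_
    rw [Matrix.conjTranspose_smul, isHermitian_pureRDM]
    simp
  · intro x hx y hy a b _ _ _
    simp only [Set.mem_ofPred_eq, Matrix.IsHermitian, Matrix.conjTranspose_add,
      Matrix.conjTranspose_smul] at *
    simp [hx, hy]

/-- `diagVec` as a real linear map. -/
def diagVecLin (d : ℕ) : Matrix (Fin d) (Fin d) ℂ →ₗ[ℝ] (Fin d → ℝ) where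
  toFun := diagVec
  map_add' x y := by ext; simp [diagVec]
  map_smul' c x := by ext; simp [diagVec]

/-- Real diagonal matrices, as a real linear map. -/
def diagonalLin (d : ℕ) : (Fin d → ℝ) →ₗ[ℝ] Matrix (Fin d) (Fin d) ℂ where
  toFun μ := Matrix.diagonal fun i => (μ i : ℂ)
  map_add' x y := by ext i j; simp [Matrix.diagonal_apply]; split_ifs <;> simp
  map_smul' c x := by ext i j; simp [Matrix.diagonal_apply]

theorem diagonal_mem_relaxedEns1 (w_nonneg : ∀ j, 0 ≤ w j) (w_sum : ∑ j, w j = 1)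
    {μ : Fin d → ℝ} (hμ : μ ∈ convexHull ℝ (configMixtures (n + 1) d w)) :
    (Matrix.diagonal fun i => (μ i : ℂ)) ∈ relaxedEns1 n d w := by
  have h1 : (Matrix.diagonal fun i => (μ i : ℂ)) ∈
    diagonalLin d '' convexHull ℝ (configMixtures (n + 1) d w) := ⟨μ, hμ, rfl⟩
  rw [LinearMap.image_convexHull] at h1
  refine convexHull_mono ?_ h1
  rw [ens1_eq_range w_nonneg w_sum]
  rintro _ ⟨_, ⟨c, rfl⟩, rfl⟩
  refine ⟨(slaterBasis (n + 1) d).reindex c.symm, ?_⟩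
  dsimp only
  rw [oneRDM_mixOp]
  simp only [OrthonormalBasis.reindex_apply, Equiv.symm_symm, pureRDM_slaterBasis]
  rw [map_sum]
  refine sum_congr rfl fun j _ => ?_
  rw [map_smul]
  ext i k
  simp [diagonalLin]

/-- This expresses the site occupations through the Slater diagonal alone, the form to which Schur's
theorem applies. -/
theorem diagVec_oneRDM_mixOp {ι : Type*} [Fintype ι]
    (b : OrthonormalBasis ι ℂ (fermionSpace (n + 1) d)) (a : ι → ℝ) :
    diagVec (oneRDM (mixOp b a)) =
      ∑ s, basisDiag (slaterBasis (n + 1) d) (mixOp b a) s • occVec s := by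
  ext i
  have h1 (s) : basisDiag (slaterBasis (n + 1) d) (mixOp b a) s =
      ∑ k, a k * ‖inner ℂ (slaterBasis (n + 1) d s) (b k)‖ ^ 2 := by
    rw [basisDiag_mixOp_apply]
    refine sum_congr rfl fun k _ => congrArg (fun r : ℝ => a k * r ^ 2) ?_
    exact norm_inner_symm (𝕜 := ℂ) (E := fermionSpace (n + 1) d) (b k) (slaterBasis (n + 1) d s)
  rw [oneRDM_mixOp]
  simp only [diagVec, Matrix.sum_apply, Matrix.smul_apply, pureRDM_apply_self, smul_eq_mul,
    Finset.sum_apply, Pi.smul_apply, h1, ← Complex.ofReal_mul, Complex.re_sum, Complex.ofReal_re,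
    mul_sum, sum_mul]
  rw [sum_comm]
  exact sum_congr rfl fun k _ => sum_congr rfl fun s _ => by ring

theorem diagVec_mem_of_mem_relaxedEns1 (w_nonneg : ∀ j, 0 ≤ w j) (w_sum : ∑ j, w j = 1)
    {γ : Matrix (Fin d) (Fin d) ℂ} (hγ : γ ∈ relaxedEns1 n d w) :
    diagVec γ ∈ convexHull ℝ (configMixtures (n + 1) d w) := by
  have h1 : diagVec γ ∈ diagVecLin d '' convexHull ℝ (ens1 n d w) := ⟨γ, hγ, rfl⟩
  rw [LinearMap.image_convexHull] at h1
  refine convexHull_min ?_ (convex_convexHull ℝ _) h1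
  rw [ens1_eq_range w_nonneg w_sum]
  rintro _ ⟨_, ⟨b, rfl⟩, rfl⟩
  change diagVec (oneRDM (mixOp b w)) ∈ _
  rw [diagVec_oneRDM_mixOp]
  let c : Config (n + 1) d ≃ Fin (d.choose (n + 1)) := Fintype.equivFinOfCardEq (card_config _ _)
  have h2 := basisDiag_mixOp_mem b ((slaterBasis (n + 1) d).reindex c) w
  let f : (Fin (d.choose (n + 1)) → ℝ) →ₗ[ℝ] (Fin d → ℝ) :=
    Fintype.linearCombination ℝ fun j => occVec (c.symm j)
  have h3 : ∑ s, basisDiag (slaterBasis (n + 1) d) (mixOp b w) s • occVec s =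
      f (basisDiag ((slaterBasis (n + 1) d).reindex c) (mixOp b w)) := by
    rw [Fintype.linearCombination_apply, ← Equiv.sum_comp c]
    simp [basisDiag]
  rw [h3]
  have h4 := Set.mem_image_of_mem f h2
  rw [LinearMap.image_convexHull] at h4
  refine convexHull_mono ?_ h4
  rintro _ ⟨_, ⟨σ, rfl⟩, rfl⟩
  refine ⟨σ.symm.trans c.symm, ?_⟩
  dsimp only
  rw [Fintype.linearCombination_apply, ← Equiv.sum_comp σ]
  simp

/-- Unitary invariance allows γ to be replaced by the diagonal matrix of its eigenvalues, for which
spectrum and site occupations coincide. -/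
theorem mem_relaxedEns1_iff (w_nonneg : ∀ j, 0 ≤ w j) (w_sum : ∑ j, w j = 1)
    {γ : Matrix (Fin d) (Fin d) ℂ} (hγ : γ.IsHermitian) :
    γ ∈ relaxedEns1 n d w ↔ hγ.eigenvalues ∈ convexHull ℝ (configMixtures (n + 1) d w) := by
  set U : Matrix (Fin d) (Fin d) ℂ := hγ.eigenvectorUnitary.val with hUdef
  have hU : U * U.conjTranspose = 1 := Matrix.mem_unitaryGroup_iff.1 hγ.eigenvectorUnitary.2
  have hU' : U.conjTranspose * U = 1 := mul_eq_one_comm.1 hU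
  have hspec : γ = U * (Matrix.diagonal fun i => (hγ.eigenvalues i : ℂ)) * U.conjTranspose := by
    have := hγ.spectral_theorem
    rw [Unitary.conjStarAlgAut_apply] at this
    exact this
  constructor
  · intro h
    have h1 := conj_mem_relaxedEns1 w_nonneg w_sum (U := U.conjTranspose)
      (by rwa [Matrix.conjTranspose_conjTranspose]) h
    have h2 : U.conjTranspose * γ * U.conjTranspose.conjTranspose =
        Matrix.diagonal fun i => (hγ.eigenvalues i : ℂ) := by
      rw [Matrix.conjTranspose_conjTranspose]
      nth_rw 1 [hspec]
      rw [← Matrix.mul_assoc, ← Matrix.mul_assoc, hU', Matrix.one_mul, Matrix.mul_assoc, hU',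
        Matrix.mul_one]
    rw [h2] at h1
    have h3 := diagVec_mem_of_mem_relaxedEns1 w_nonneg w_sum h1
    have h4 : diagVec (Matrix.diagonal fun i => (hγ.eigenvalues i : ℂ)) = hγ.eigenvalues := by
      ext i
      simp [diagVec]
    rwa [h4] at h3
  · intro h
    rw [hspec]
    exact conj_mem_relaxedEns1 w_nonneg w_sum hU (diagonal_mem_relaxedEns1 w_nonneg w_sum h)

end WEnsemble

namespace WEnsemble

/-! ### Domains -/

theorem mem_effDomain {E : Type*} {f : E → EReal} {x : E} : x ∈ effDomain f ↔ f x < ⊤ := Iff.rfl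

/-- The domain of the lower convex envelope is the convex hull of the domain. -/
theorem effDomain_convEnvelope {E : Type*} [AddCommGroup E] [Module ℝ E] (f : E → EReal) :
    effDomain (convEnvelope f) = convexHull ℝ (effDomain f) := by
  -- The domain is the projection of the epigraph, and projections commute with convex hulls.
  have h1 : effDomain f = LinearMap.fst ℝ E ℝ '' epigraph f := by
    ext x
    constructor
    · intro h
      obtain ⟨y, hy, -⟩ := EReal.lt_iff_exists_real_btwn.1 h
      exact ⟨(x, y), hy.le, rfl⟩
    · rintro ⟨⟨x, y⟩, h, rfl⟩
      exact lt_of_le_of_lt h (EReal.coe_lt_top y)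
  rw [h1, ← LinearMap.image_convexHull]
  ext x
  constructor
  · intro h
    obtain ⟨_, ⟨y, hy, rfl⟩, -⟩ := sInf_lt_iff.1 (mem_effDomain.1 h)
    exact ⟨(x, y), hy, rfl⟩
  · rintro ⟨⟨x, y⟩, h, rfl⟩
    exact mem_effDomain.2 <| sInf_lt_iff.2 ⟨y, ⟨y, h, rfl⟩, EReal.coe_lt_top y⟩

/-- Each admissible Γ contributes a real number, so the infimum is below `⊤` exactly when some Γ is
admissible. -/
theorem effDomain_densityFunctional {n d : ℕ} (w : Fin (d.choose (n + 1)) → ℝ)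
    (t W : FermionOp (n + 1) d) :
    effDomain (densityFunctional w t W) = diagVec '' ens1 n d w := by
  ext x
  constructor
  · intro h
    obtain ⟨_, ⟨Γ, hΓ, hx, -⟩, -⟩ := sInf_lt_iff.1 (mem_effDomain.1 h)
    exact ⟨_, ⟨Γ, hΓ, rfl⟩, hx⟩
  · rintro ⟨_, ⟨Γ, hΓ, rfl⟩, rfl⟩
    exact mem_effDomain.2 <| sInf_lt_iff.2 ⟨_, ⟨Γ, hΓ, rfl, rfl⟩, EReal.coe_lt_top _⟩

theorem effDomain_relaxedDensityFunctional {n d : ℕ} (w : Fin (d.choose (n + 1)) → ℝ)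
    (t W : FermionOp (n + 1) d) :
    effDomain (relaxedDensityFunctional w t W) = convexHull ℝ (diagVec '' ens1 n d w) := by
  rw [relaxedDensityFunctional, effDomain_convEnvelope, effDomain_densityFunctional]

/-- `oneRDM` as a real linear map. -/
noncomputable def oneRDMLin (n d : ℕ) : FermionOp (n + 1) d →ₗ[ℝ] Matrix (Fin d) (Fin d) ℂ where
  toFun := oneRDM
  map_add' Γ Γ' := by
    have h (x y) : matrixElement (Γ + Γ') x y = matrixElement Γ x y + matrixElement Γ' x y := rfl
    ext i j
    simp [oneRDM, h, sum_add_distrib, mul_add]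
  map_smul' c Γ := by
    have h (x y) : matrixElement (c • Γ) x y = (c : ℂ) * matrixElement Γ x y := rfl
    ext i j
    simp [oneRDM, h, ← mul_sum, mul_left_comm]

end WEnsemble

theorem mainTheorem8 (n d : ℕ) (w : Fin (d.choose (n + 1)) → ℝ)
    (w_anti : Antitone w) (w_nonneg : ∀ j, 0 ≤ w j) (w_sum : ∑ j, w j = 1)
    (t W : FermionOp (n + 1) d) (t_herm : HermitianOp t) (W_herm : HermitianOp W) :
    -- the domain of the relaxed functional
    effDomain (relaxedDensityFunctional w t W) = diagVec '' relaxedEns1 n d w ∧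
    effDomain (relaxedDensityFunctional w t W) =
      diagVec '' (oneRDM '' relaxedEnsN (n + 1) d w) ∧
    effDomain (relaxedDensityFunctional w t W) =
      {occ | ∃ Γ ∈ densityOps (n + 1) d, ∃ w' : Fin (d.choose (n + 1)) → ℝ,
        OpHasSpectrum Γ w' ∧ Majorized w' w ∧ diagVec (oneRDM Γ) = occ} ∧
    -- the constraints on the natural occupation numbers
    (∀ (γ : Matrix (Fin d) (Fin d) ℂ) (hγ : γ.IsHermitian),
      γ ∈ relaxedEns1 n d w ↔ ExclusionPrinciple (n + 1) d w hγ.eigenvalues) ∧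
    -- the same constraints on the site occupation numbers
    (∀ occ : Fin d → ℝ, occ ∈ effDomain (relaxedDensityFunctional w t W) ↔
      ExclusionPrinciple (n + 1) d w occ) ∧
    effDomain (relaxedDensityFunctional w t W) = spectralPolytope n d w ∧
    -- every description by constraints on the decreasingly ordered natural occupation numbers
    -- is also one by constraints on the decreasingly ordered site occupation numbers
    (∀ C : Set (Fin d → ℝ),
      (∀ (γ : Matrix (Fin d) (Fin d) ℂ) (hγ : γ.IsHermitian),
        γ ∈ relaxedEns1 n d w ↔ sortDown hγ.eigenvalues ∈ C) →
      ∀ occ : Fin d → ℝ, occ ∈ effDomain (relaxedDensityFunctional w t W) ↔ sortDown occ ∈ C) := by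
  have hdom : effDomain (relaxedDensityFunctional w t W) = diagVec '' relaxedEns1 n d w := by
    rw [effDomain_relaxedDensityFunctional]
    exact ((diagVecLin d).image_convexHull _).symm
  have hrdm : relaxedEns1 n d w = oneRDM '' relaxedEnsN (n + 1) d w :=
    ((oneRDMLin n d).image_convexHull _).symm
  have hmem : ∀ occ : Fin d → ℝ, occ ∈ effDomain (relaxedDensityFunctional w t W) ↔
      occ ∈ convexHull ℝ (configMixtures (n + 1) d w) := by
    intro occ
    rw [hdom]
    constructor
    · rintro ⟨γ, hγ, rfl⟩
      exact diagVec_mem_of_mem_relaxedEns1 w_nonneg w_sum hγ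
    · intro h
      exact ⟨_, diagonal_mem_relaxedEns1 w_nonneg w_sum h, by ext i; simp [diagVec]⟩
  have hdiag : ∀ occ : Fin d → ℝ, (Matrix.diagonal fun i => (occ i : ℂ)).IsHermitian := by
    intro occ
    refine Matrix.isHermitian_diagonal_of_self_adjoint _ ?_
    ext i
    simp
  -- Site occupations are thereby tested on diagonal matrices, whose spectrum is the occupation
  -- vector itself up to order.
  have hmem' : ∀ occ : Fin d → ℝ, occ ∈ effDomain (relaxedDensityFunctional w t W) ↔
      (Matrix.diagonal fun i => (occ i : ℂ)) ∈ relaxedEns1 n d w := by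
    intro occ
    refine ⟨fun h => diagonal_mem_relaxedEns1 w_nonneg w_sum ((hmem occ).1 h), fun h => ?_⟩
    rw [hdom]
    exact ⟨_, h, by ext i; simp [diagVec]⟩
  refine ⟨hdom, by rw [hdom, hrdm], ?_, ?_, ?_, ?_, ?_⟩
  · rw [hdom, hrdm]
    ext occ
    constructor
    · rintro ⟨_, ⟨Γ, hΓ, rfl⟩, rfl⟩
      obtain ⟨h1, w', h2, h3⟩ :=
        (mem_relaxedEnsN_iff (finrank_fermionSpace _ _) w_nonneg w_sum).1 hΓ
      exact ⟨Γ, h1, w', h2, h3, rfl⟩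
    · rintro ⟨Γ, h1, w', h2, h3, rfl⟩
      exact ⟨_, ⟨Γ, (mem_relaxedEnsN_iff (finrank_fermionSpace _ _) w_nonneg w_sum).2
        ⟨h1, w', h2, h3⟩, rfl⟩, rfl⟩
  · intro γ hγ
    rw [exclusionPrinciple_iff w_anti]
    exact mem_relaxedEns1_iff w_nonneg w_sum hγ
  · intro occ
    rw [exclusionPrinciple_iff w_anti, hmem]
  · ext occ
    constructor
    · intro h
      exact ⟨_, (hmem' occ).1 h, roots_charpoly_diagonal _⟩
    · rintro ⟨γ, hγ, hspec⟩
      have hH := isHermitian_of_mem_relaxedEns1 w_nonneg w_sum hγ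
      obtain ⟨σ, rfl⟩ := exists_perm_of_map_eq
        (hspec.symm.trans hH.roots_charpoly_eq_eigenvalues)
      rw [hmem]
      -- The polytope is invariant under relabelling of sites, so the order in which the spectrum is
      -- listed does not matter.
      exact comp_perm_mem_convexHull σ (fun v hv => comp_perm_mem_configMixtures hv σ)
        ((mem_relaxedEns1_iff w_nonneg w_sum hH).1 hγ)
  · intro C hC occ
    rw [hmem', hC _ (hdiag occ)]
    obtain ⟨σ, hσ⟩ := exists_perm_of_map_eq (u := occ) (v := (hdiag occ).eigenvalues)
      ((roots_charpoly_diagonal _).symm.trans (hdiag occ).roots_charpoly_eq_eigenvalues)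
    rw [← sortDown_comp_perm (hdiag occ).eigenvalues σ, ← hσ]
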